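/- Let $r$ be a quadratic irrational number (an irrational real root of a quadratic polynomial with integer coefficients), let $p_0,q_0\in\mathbb{R}$ satisfy $p_0^2+q_0^2=1$ and $p_0/q_0=r$, and let $L$ be the Lagrangian on $T\mathbb{T}^2$, $\mathbb{T}^2=\mathbb{R}^2/\mathbb{Z}^2$, defined by $$L(x,y,u,v)=\frac{u^2+v^2}{2}-(p_0u+q_0v).$$ For a function $f$ on $\mathbb{T}^2$ let $(L+f)(x,y,u,v)=L(x,y,u,v)+f(x,y)$. An $(L+f)$-minimizing measure is a compactly supported Borel probability measure $\mu$ on $T\mathbb{T}^2$, invariant under the Euler--Lagrange flow of $L+f$, such that $\int (L+f)\,d\mu\le\int (L+f)\,d\nu$ for every compactly supported Borel probability measure $\nu$ on $T\mathbb{T}^2$ invariant under this flow. A periodic curve $\gamma$ in $T\mathbb{T}^2$, of period $T>0$, is called $(L+f)$-minimizing if the probability measure $g\mapsto\frac1T\int_0^T g(\gamma(t))\,dt$ equidistributed along $\gamma$ is $(L+f)$-minimizing. Then there is a constant $C>0$, depending only on $L$, such that for every periodic orbit $\gamma$ of the Euler--Lagrange flow of $L$ and every function $f$ of class $C^4$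 on $\mathbb{T}^2$, if $\gamma$ is $(L+f)$-minimizing, then $\|f\|_{C^4}\ge C$, where $\|f\|_{C^4}=\max_{0\le k\le 4}\ \sup_{\mathbb{T}^2}\|D^kf\|$ and $\|D^kf\|$ is the norm of $D^kf$ as a $k$-linear form, with the norm $\max(|u|,|v|)$ on $\mathbb{R}^2$. -/

import Mathlib

open MeasureTheory

noncomputable section

/-- The torus `ℝ² / ℤ²`. -/
abbrev Torus : Type := UnitAddCircle × UnitAddCircle

/-- The tangent bundle of the torus, with its canonical coordinates `((x, y), (u, v))`. -/
abbrev TangentTorus : Type := Torus × (ℝ × ℝ)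

/-- The covering map `ℝ² → ℝ² / ℤ²`. -/
def torusProj (x : ℝ × ℝ) : Torus := ((x.1 : UnitAddCircle), (x.2 : UnitAddCircle))

/-- `f` is of class `C^n` on the torus: its `ℤ²`-periodic lift to the plane is. -/
def TorusContDiff (n : ℕ) (f : Torus → ℝ) : Prop :=
  ContDiff ℝ n (fun x : ℝ × ℝ => f (torusProj x))

/-- The `C^n` norm of a function of class `C^n` on the torus: the maximum over `0 ≤ k ≤ n` of the
supremum of the norm of its `k`-th differential. -/
def torusCNorm (n : ℕ) (f : Torus → ℝ) : ℝ :=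
  ⨆ k : Fin (n + 1), ⨆ x : ℝ × ℝ,
    ‖iteratedFDeriv ℝ (k : ℕ) (fun y : ℝ × ℝ => f (torusProj y)) x‖

/-- The Lagrangian `(u² + v²) / 2 - (p₀ u + q₀ v)`. -/
def exampleLagrangian (p₀ q₀ : ℝ) (z : TangentTorus) : ℝ :=
  (z.2.1 ^ 2 + z.2.2 ^ 2) / 2 - (p₀ * z.2.1 + q₀ * z.2.2)

/-- The perturbation `Λ + f` of the Lagrangian `Λ` by the potential `f`. -/
def addPotential (Λ : TangentTorus → ℝ) (f : Torus → ℝ) (z : TangentTorus) : ℝ :=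
  Λ z + f z.1

/-- `x : ℝ → ℝ²` (a lift of a curve in the torus) is a global solution of the Euler-Lagrange
equation `d/dt ∂Λ/∂v (x, x') = ∂Λ/∂x (x, x')`. -/
def IsExtremal (Λ : TangentTorus → ℝ) (x : ℝ → ℝ × ℝ) : Prop :=
  Differentiable ℝ x ∧
    ∀ t : ℝ, HasDerivAt
      (fun s : ℝ => fderiv ℝ (fun w : ℝ × ℝ => Λ (torusProj (x s), w)) (deriv x s))
      (fderiv ℝ (fun y : ℝ × ℝ => Λ (torusProj y, deriv x t)) (x t)) t

/-- `γ` is a (parametrized) orbit, in the tangent bundle, of the Euler-Lagrange flow of `Λ`. -/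
def IsOrbit (Λ : TangentTorus → ℝ) (γ : ℝ → TangentTorus) : Prop :=
  ∃ x : ℝ → ℝ × ℝ, IsExtremal Λ x ∧ ∀ t, γ t = (torusProj (x t), deriv x t)

/-- `φ` is the Euler-Lagrange flow of `Λ`. -/
def IsEulerLagrangeFlow (Λ : TangentTorus → ℝ) (φ : ℝ → TangentTorus → TangentTorus) : Prop :=
  ∀ z, φ 0 z = z ∧ IsOrbit Λ (fun t => φ t z)

/-- The compactly supported Borel probability measures on the tangent bundle which are invariant
under the Euler-Lagrange flow of `Λ`. -/
def invariantMeasures (Λ : TangentTorus → ℝ) : Set (Measure TangentTorus) :=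
  {μ | IsProbabilityMeasure μ ∧ (∃ K : Set TangentTorus, IsCompact K ∧ μ Kᶜ = 0) ∧
    ∃ φ : ℝ → TangentTorus → TangentTorus, IsEulerLagrangeFlow Λ φ ∧
      ∀ t : ℝ, MeasurePreserving (φ t) μ μ}

/-- `μ` minimizes the action `∫ Λ dμ` among the invariant measures of `Λ`. -/
def IsMinimizingMeasure (Λ : TangentTorus → ℝ) (μ : Measure TangentTorus) : Prop :=
  μ ∈ invariantMeasures Λ ∧ ∀ ν ∈ invariantMeasures Λ, ∫ z, Λ z ∂μ ≤ ∫ z, Λ z ∂ν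

/-- `γ` is a periodic orbit of the Euler-Lagrange flow of `Λ`, and `T > 0` is a period of `γ`. -/
def IsPeriodicOrbit (Λ : TangentTorus → ℝ) (γ : ℝ → TangentTorus) (T : ℝ) : Prop :=
  IsOrbit Λ γ ∧ 0 < T ∧ Function.Periodic γ T

/-- The probability measure equidistributed along a curve `γ` of period `T > 0`, that is
`g ↦ (1 / T) ∫₀ᵀ g (γ t) dt`. It does not depend on which period `T` is used. -/
def orbitMeasure (γ : ℝ → TangentTorus) (T : ℝ) : Measure TangentTorus :=
  Measure.map γ ((ENNReal.ofReal T)⁻¹ • volume.restrict (Set.Ioc 0 T))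

/-- The periodic curve `γ`, of period `T`, is `Λ`-minimizing. -/
def IsMinimizingOrbit (Λ : TangentTorus → ℝ) (γ : ℝ → TangentTorus) (T : ℝ) : Prop :=
  IsMinimizingMeasure Λ (orbitMeasure γ T)

/-- `r` is irrational and is a root of a quadratic polynomial with integer coefficients. -/
def IsQuadraticIrrational (r : ℝ) : Prop :=
  Irrational r ∧ ∃ a b c : ℤ, a ≠ 0 ∧ (a : ℝ) * r ^ 2 + b * r + c = 0

end

/-! Write ω = (p₀, q₀) and ε for the C⁴ norm of f. Orbits of L are straight lines, so γ has a
constant velocity w with T • w integral. Invariance of its measure under the flow of L + f forces ∇f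
to vanish along it (`liftGrad_eq_zero_of_invariant`). Hence f is constant there and the mean action
of γ is |w - ω|²/2 - 1/2 + f(x₀).

Suppose w is close to ω, let n be the primitive integer vector along w and h = 1/|n|. The lifts of
the closed line are parallel lines at spacing h. Since df vanishes on all of them, Rolle's theorem
gives |D²f| ≤ 6εh² and |f - f(x₀)| ≤ 6εh⁴ (`hessian_estimates`). A quadratic slope is badly
approximable, so the angle between n and ω is at least of order h², and |w - ω|²/2 ≥ ch⁴
(`exists_pos_mul_pow_four_le`). Velocities far from ω, including w = 0, satisfy the same bounds with
h = 1 (`exists_scale`).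

At the same scale there are an integer vector k and a time τ ≤ A/h with |k/τ - ω|²/2 ≤ (c/2)h⁴
(`exists_good_approximation`). Now τ²|D²f| ≤ 6εA², so for small ε the action over time τ is convex
for fixed endpoints, and some closed orbit of L + f in the class k does no worse than the uniform
motion (`exists_invariantMeasure_action_le`). Minimality of γ yields ch⁴ ≤ (c/2)h⁴ + 6εh⁴. Thus ε ≥
c/12, unless ε already exceeds the threshold 1/(24A²). -/

noncomputable section

/-! ### Lifting to the plane. -/

/-- The linear form on the plane with coefficients `a`. -/
def pairForm (a : ℝ × ℝ) : ℝ × ℝ →L[ℝ] ℝ :=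
  a.1 • ContinuousLinearMap.fst ℝ ℝ ℝ + a.2 • ContinuousLinearMap.snd ℝ ℝ ℝ

@[simp]
lemma pairForm_apply (a v : ℝ × ℝ) : pairForm a v = a.1 * v.1 + a.2 * v.2 := by
  simp [pairForm]

/-- An integer vector, seen in the plane. -/
def intVec (m : ℤ × ℤ) : ℝ × ℝ := ((m.1 : ℝ), (m.2 : ℝ))

@[simp]
lemma intVec_fst (m : ℤ × ℤ) : (intVec m).1 = m.1 := rfl

@[simp]
lemma intVec_snd (m : ℤ × ℤ) : (intVec m).2 = m.2 := rfl

lemma torusProj_eq_iff {x y : ℝ × ℝ} :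
    torusProj x = torusProj y ↔ ∃ m : ℤ × ℤ, x = y + intVec m := by
  have key : ∀ a b : ℝ, (a : UnitAddCircle) = (b : UnitAddCircle) ↔ ∃ n : ℤ, a = b + n := by
    intro a b
    rw [← sub_eq_zero, ← AddCircle.coe_sub, AddCircle.coe_eq_zero_iff]
    constructor
    · rintro ⟨n, hn⟩
      exact ⟨n, by simp at hn; linarith⟩
    · rintro ⟨n, hn⟩
      exact ⟨n, by simp [hn]⟩
  unfold torusProj
  rw [Prod.mk.injEq, key, key]
  constructor
  · rintro ⟨⟨m, hm⟩, ⟨n, hn⟩⟩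
    exact ⟨(m, n), Prod.ext hm hn⟩
  · rintro ⟨m, rfl⟩
    exact ⟨⟨m.1, rfl⟩, ⟨m.2, rfl⟩⟩

@[simp]
lemma torusProj_add_intVec (x : ℝ × ℝ) (m : ℤ × ℤ) : torusProj (x + intVec m) = torusProj x :=
  torusProj_eq_iff.2 ⟨m, rfl⟩

lemma isOpenQuotientMap_torusProj : IsOpenQuotientMap torusProj :=
  IsOpenQuotientMap.prodMap (f := fun x : ℝ => (x : UnitAddCircle))
    (g := fun x : ℝ => (x : UnitAddCircle))
    QuotientAddGroup.isOpenQuotientMap_mk QuotientAddGroup.isOpenQuotientMap_mk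

lemma continuous_torusProj : Continuous torusProj := isOpenQuotientMap_torusProj.continuous

/-- The gradient of the lift of `f` to the plane. -/
def liftGrad (f : Torus → ℝ) (x : ℝ × ℝ) : ℝ × ℝ :=
  (fderiv ℝ (fun y : ℝ × ℝ => f (torusProj y)) x (1, 0),
    fderiv ℝ (fun y : ℝ × ℝ => f (torusProj y)) x (0, 1))

lemma clm_eq_pairForm (l : ℝ × ℝ →L[ℝ] ℝ) : l = pairForm (l (1, 0), l (0, 1)) := by
  ext <;> simp

lemma fderiv_eq_pairForm_liftGrad (f : Torus → ℝ) (x : ℝ × ℝ) :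
    fderiv ℝ (fun y : ℝ × ℝ => f (torusProj y)) x = pairForm (liftGrad f x) :=
  clm_eq_pairForm _

lemma liftGrad_add_intVec (f : Torus → ℝ) (x : ℝ × ℝ) (m : ℤ × ℤ) :
    liftGrad f (x + intVec m) = liftGrad f x := by
  have h := fderiv_comp_add_right (𝕜 := ℝ) (f := fun y : ℝ × ℝ => f (torusProj y)) (x := x)
    (intVec m)
  simp only [torusProj_add_intVec] at h
  simp [liftGrad, ← h]

lemma HasDerivAt.fst {u : ℝ → ℝ × ℝ} {u' : ℝ × ℝ} {t : ℝ} (h : HasDerivAt u u' t) :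
    HasDerivAt (fun s => (u s).1) u'.1 t :=
  (hasFDerivAt_fst (𝕜 := ℝ) (p := u t)).comp_hasDerivAt t h

lemma HasDerivAt.snd {u : ℝ → ℝ × ℝ} {u' : ℝ × ℝ} {t : ℝ} (h : HasDerivAt u u' t) :
    HasDerivAt (fun s => (u s).2) u'.2 t :=
  (hasFDerivAt_snd (𝕜 := ℝ) (p := u t)).comp_hasDerivAt t h

lemma hasDerivAt_pairForm_iff {u : ℝ → ℝ × ℝ} {u' : ℝ × ℝ} {t : ℝ} :
    HasDerivAt (fun s => pairForm (u s)) (pairForm u') t ↔ HasDerivAt u u' t := by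
  constructor
  · intro h
    have h1 := h.clm_apply (hasDerivAt_const t ((1, 0) : ℝ × ℝ))
    have h2 := h.clm_apply (hasDerivAt_const t ((0, 1) : ℝ × ℝ))
    simp at h1 h2
    exact h1.prodMk h2
  · intro h
    exact (h.fst.smul_const (ContinuousLinearMap.fst ℝ ℝ ℝ)).fun_add
      (h.snd.smul_const (ContinuousLinearMap.snd ℝ ℝ ℝ))

/-! ### The Euler-Lagrange equation as Newton's equation. -/

/-- The momentum is the velocity minus a constant, which differentiation kills: the linear term of
the Lagrangian changes actions but not the flow. The force is +∇f because f is added to the kinetic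
energy. -/
lemma isExtremal_addPotential_iff {p₀ q₀ : ℝ} {f : Torus → ℝ} {x : ℝ → ℝ × ℝ} :
    IsExtremal (addPotential (exampleLagrangian p₀ q₀) f) x ↔
      Differentiable ℝ x ∧ ∀ t, HasDerivAt (deriv x) (liftGrad f (x t)) t := by
  unfold IsExtremal
  refine and_congr_right fun _ => forall_congr' fun t => ?_
  have h1 : (fun s : ℝ => fderiv ℝ (fun w : ℝ × ℝ =>
      addPotential (exampleLagrangian p₀ q₀) f (torusProj (x s), w)) (deriv x s)) =
      fun s => pairForm (deriv x s - (p₀, q₀)) := by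
    funext s
    refine HasFDerivAt.fderiv ?_
    unfold addPotential exampleLagrangian
    simp only [div_eq_mul_inv]
    have a1 := hasFDerivAt_fst (𝕜 := ℝ) (p := deriv x s)
    have a2 := hasFDerivAt_snd (𝕜 := ℝ) (p := deriv x s)
    refine (((((a1.pow 2).fun_add (a2.pow 2)).mul_const (2 : ℝ)⁻¹).fun_sub
      ((a1.const_mul p₀).fun_add (a2.const_mul q₀))).add_const
        (f (torusProj (x s)))).congr_fderiv ?_
    ext <;> simp
  have h2 : fderiv ℝ (fun y : ℝ × ℝ =>
      addPotential (exampleLagrangian p₀ q₀) f (torusProj y, deriv x t)) (x t) =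
      pairForm (liftGrad f (x t)) := by
    rw [← fderiv_eq_pairForm_liftGrad]
    unfold addPotential exampleLagrangian
    simp only
    rw [fderiv_const_add]
  rw [h1, h2, hasDerivAt_pairForm_iff]
  constructor
  · intro h
    simpa using h.add_const (p₀, q₀)
  · intro h
    exact h.sub_const (p₀, q₀)

lemma exampleLagrangian_eq_addPotential (p₀ q₀ : ℝ) :
    exampleLagrangian p₀ q₀ = addPotential (exampleLagrangian p₀ q₀) 0 := by
  funext z
  simp [addPotential]

lemma isExtremal_exampleLagrangian {p₀ q₀ : ℝ} {x : ℝ → ℝ × ℝ}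
    (h : IsExtremal (exampleLagrangian p₀ q₀) x) : ∃ w : ℝ × ℝ, ∀ t, x t = x 0 + t • w := by
  rw [exampleLagrangian_eq_addPotential, isExtremal_addPotential_iff] at h
  obtain ⟨hd, h⟩ := h
  have h0 : ∀ y, liftGrad 0 y = 0 := fun y => by simp [liftGrad]
  simp only [h0] at h
  have hc : ∀ t, deriv x t = deriv x 0 := fun t =>
    is_const_of_deriv_eq_zero (fun t => (h t).differentiableAt) (fun t => (h t).deriv) t 0
  refine ⟨deriv x 0, fun t => ?_⟩
  have h3 : ∀ t, HasDerivAt (fun t => x t - t • deriv x 0) 0 t := by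
    intro t
    have := (hd t).hasDerivAt.fun_sub ((hasDerivAt_id t).smul_const (deriv x 0))
    rw [hc t] at this
    simpa using this
  have := is_const_of_deriv_eq_zero (fun t => (h3 t).differentiableAt) (fun t => (h3 t).deriv) t 0
  simp at this
  rw [← this]; abel

/-- The first order vector field of a second order equation is Lipschitz when the force is. -/
lemma lipschitzWith_phase {g : ℝ × ℝ → ℝ × ℝ} {K : NNReal} (hg : LipschitzWith K g) :
    LipschitzWith (max 1 K) (fun z : (ℝ × ℝ) × (ℝ × ℝ) => (z.2, g z.1)) := by
  have := (LipschitzWith.prod_snd (α := ℝ × ℝ) (β := ℝ × ℝ)).prodMk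
    (hg.comp (LipschitzWith.prod_fst (α := ℝ × ℝ) (β := ℝ × ℝ)))
  simpa using this

lemma newton_unique {g : ℝ × ℝ → ℝ × ℝ} {K : NNReal} (hg : LipschitzWith K g)
    {x y x' y' : ℝ → ℝ × ℝ} (hx : ∀ t, HasDerivAt x (x' t) t)
    (hx' : ∀ t, HasDerivAt x' (g (x t)) t) (hy : ∀ t, HasDerivAt y (y' t) t)
    (hy' : ∀ t, HasDerivAt y' (g (y t)) t) {a : ℝ} (h : x a = y a) (h' : x' a = y' a) :
    x = y ∧ x' = y' := by
  have := ODE_solution_unique_univ (v := fun _ z => (z.2, g z.1)) (s := fun _ => Set.univ)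
    (f := fun t => (x t, x' t)) (g := fun t => (y t, y' t)) (t₀ := a)
    (fun _ => (lipschitzWith_phase hg).lipschitzOnWith)
    (fun t => ⟨(hx t).prodMk (hx' t), trivial⟩) (fun t => ⟨(hy t).prodMk (hy' t), trivial⟩)
    (by simp [h, h'])
  exact ⟨funext fun t => congrArg Prod.fst (congrFun this t),
    funext fun t => congrArg Prod.snd (congrFun this t)⟩

lemma newton_unique_Icc {g : ℝ × ℝ → ℝ × ℝ} {K : NNReal} (hg : LipschitzWith K g)
    {x y x' y' : ℝ → ℝ × ℝ} {a b : ℝ} (hx : ∀ t ∈ Set.Icc a b, HasDerivAt x (x' t) t)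
    (hx' : ∀ t ∈ Set.Icc a b, HasDerivAt x' (g (x t)) t)
    (hy : ∀ t ∈ Set.Icc a b, HasDerivAt y (y' t) t)
    (hy' : ∀ t ∈ Set.Icc a b, HasDerivAt y' (g (y t)) t) (h : x a = y a) (h' : x' a = y' a) :
    ∀ t ∈ Set.Icc a b, x t = y t ∧ x' t = y' t := by
  have := ODE_solution_unique (v := fun _ z => (z.2, g z.1))
    (f := fun t => (x t, x' t)) (g := fun t => (y t, y' t)) (a := a) (b := b)
    (fun _ => lipschitzWith_phase hg)
    (fun t ht => ((hx t ht).prodMk (hx' t ht)).continuousAt.continuousWithinAt)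
    (fun t ht => ((hx t ⟨ht.1, ht.2.le⟩).prodMk (hx' t ⟨ht.1, ht.2.le⟩)).hasDerivWithinAt)
    (fun t ht => ((hy t ht).prodMk (hy' t ht)).continuousAt.continuousWithinAt)
    (fun t ht => ((hy t ⟨ht.1, ht.2.le⟩).prodMk (hy' t ⟨ht.1, ht.2.le⟩)).hasDerivWithinAt)
    (by simp [h, h'])
  exact fun t ht => ⟨congrArg Prod.fst (this ht), congrArg Prod.snd (this ht)⟩

lemma isOrbit_addPotential_iff {p₀ q₀ : ℝ} {f : Torus → ℝ} {γ : ℝ → TangentTorus} :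
    IsOrbit (addPotential (exampleLagrangian p₀ q₀) f) γ ↔ ∃ x x' : ℝ → ℝ × ℝ,
      (∀ t, HasDerivAt x (x' t) t) ∧ (∀ t, HasDerivAt x' (liftGrad f (x t)) t) ∧
      ∀ t, γ t = (torusProj (x t), x' t) := by
  constructor
  · rintro ⟨x, hx, hγ⟩
    rw [isExtremal_addPotential_iff] at hx
    exact ⟨x, deriv x, fun t => (hx.1 t).hasDerivAt, hx.2, hγ⟩
  · rintro ⟨x, x', hx, hx', hγ⟩
    have : deriv x = x' := funext fun t => (hx t).deriv
    subst this
    exact ⟨x, isExtremal_addPotential_iff.2 ⟨fun t => (hx t).differentiableAt, hx'⟩, hγ⟩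

lemma IsOrbit.continuous {p₀ q₀ : ℝ} {f : Torus → ℝ} {γ : ℝ → TangentTorus}
    (h : IsOrbit (addPotential (exampleLagrangian p₀ q₀) f) γ) : Continuous γ := by
  obtain ⟨x, x', hx, hx', hγ⟩ := isOrbit_addPotential_iff.1 h
  rw [funext hγ]
  exact (continuous_torusProj.comp (continuous_iff_continuousAt.2 fun t => (hx t).continuousAt)).prodMk
    (continuous_iff_continuousAt.2 fun t => (hx' t).continuousAt)

/-- When two orbits meet, suitable lifts differ by an integer vector; the force is periodic, so
uniqueness in the plane applies. -/
lemma IsOrbit.shift_eq {p₀ q₀ : ℝ} {f : Torus → ℝ} {K : NNReal}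
    (hK : LipschitzWith K (liftGrad f)) {γ δ : ℝ → TangentTorus}
    (hγ : IsOrbit (addPotential (exampleLagrangian p₀ q₀) f) γ)
    (hδ : IsOrbit (addPotential (exampleLagrangian p₀ q₀) f) δ) {a b : ℝ} (h : γ a = δ b) (t : ℝ) :
    γ (a + t) = δ (b + t) := by
  obtain ⟨x, x', hx, hx', hγ⟩ := isOrbit_addPotential_iff.1 hγ
  obtain ⟨y, y', hy, hy', hδ⟩ := isOrbit_addPotential_iff.1 hδ
  rw [hγ, hδ, Prod.mk.injEq, torusProj_eq_iff] at h
  obtain ⟨⟨m, hm⟩, h'⟩ := h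
  have := newton_unique hK (x := fun t => x (a + t)) (x' := fun t => x' (a + t))
    (y := fun t => y (b + t) + intVec m) (y' := fun t => y' (b + t)) (a := 0)
    (fun t => (hx _).comp_const_add _ _) (fun t => (hx' _).comp_const_add _ _)
    (fun t => ((hy _).comp_const_add _ _).add_const _)
    (fun t => by
      rw [liftGrad_add_intVec]
      exact (hy' _).comp_const_add _ _) (by simpa using hm) (by simpa using h')
  rw [hγ, hδ, Prod.mk.injEq, torusProj_eq_iff]
  exact ⟨⟨m, congrFun this.1 t⟩, congrFun this.2 t⟩

lemma continuous_of_torusContDiff {n : ℕ} {f : Torus → ℝ} (h : TorusContDiff n f) :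
    Continuous f :=
  isOpenQuotientMap_torusProj.isQuotientMap.continuous_iff.2 (ContDiff.continuous h)

lemma continuous_addPotential {p₀ q₀ : ℝ} {f : Torus → ℝ} (h : Continuous f) :
    Continuous (addPotential (exampleLagrangian p₀ q₀) f) := by
  unfold addPotential exampleLagrangian
  fun_prop

/-! ### Measures equidistributed along periodic orbits. -/

section OrbitMeasure

lemma isProbabilityMeasure_orbitMeasure {γ : ℝ → TangentTorus} (hγ : Continuous γ) {T : ℝ}
    (hT : 0 < T) : IsProbabilityMeasure (orbitMeasure γ T) := by
  constructor
  unfold orbitMeasure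
  rw [Measure.map_apply hγ.measurable MeasurableSet.univ]
  simp only [Set.preimage_univ, Measure.smul_apply, Measure.restrict_apply_univ, Real.volume_Ioc,
    sub_zero, smul_eq_mul]
  exact ENNReal.inv_mul_cancel (by simpa using hT) ENNReal.ofReal_ne_top

lemma integral_orbitMeasure {γ : ℝ → TangentTorus} (hγ : Continuous γ) {T : ℝ} (hT : 0 < T)
    {g : TangentTorus → ℝ} (hg : Continuous g) :
    ∫ z, g z ∂(orbitMeasure γ T) = T⁻¹ * ∫ t in (0 : ℝ)..T, g (γ t) := by
  unfold orbitMeasure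
  rw [integral_map hγ.measurable.aemeasurable hg.aestronglyMeasurable, integral_smul_measure,
    intervalIntegral.integral_of_le hT.le]
  simp [ENNReal.toReal_inv, hT.le]

lemma orbitMeasure_compl_image {γ : ℝ → TangentTorus} (hγ : Continuous γ) (T : ℝ) :
    IsCompact (γ '' Set.Icc 0 T) ∧ orbitMeasure γ T (γ '' Set.Icc 0 T)ᶜ = 0 := by
  have hc : IsCompact (γ '' Set.Icc 0 T) := isCompact_Icc.image hγ
  refine ⟨hc, ?_⟩
  unfold orbitMeasure
  rw [Measure.map_apply hγ.measurable hc.measurableSet.compl, Measure.smul_apply,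
    Measure.restrict_apply (hγ.measurable hc.measurableSet.compl)]
  have : γ ⁻¹' (γ '' Set.Icc 0 T)ᶜ ∩ Set.Ioc 0 T = ∅ := by
    ext t
    simp only [Set.mem_inter_iff, Set.mem_preimage, Set.mem_compl_iff, Set.mem_empty_iff_false,
      iff_false, not_and]
    intro h ht
    exact h ⟨t, ⟨ht.1.le, ht.2⟩, rfl⟩
  rw [this]
  simp

lemma measurePreserving_orbitMeasure {γ : ℝ → TangentTorus} (hγ : Continuous γ) {T : ℝ}
    (hT : 0 < T) (hp : Function.Periodic γ T) {ψ : TangentTorus → TangentTorus}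
    (hψ : Measurable ψ) {s : ℝ} (h : ∀ t, ψ (γ t) = γ (s + t)) :
    MeasurePreserving ψ (orbitMeasure γ T) (orbitMeasure γ T) := by
  refine ⟨hψ, ?_⟩
  have hv : ∀ A : Set TangentTorus, MeasurableSet A →
      volume (γ ⁻¹' (ψ ⁻¹' A) ∩ Set.Ioc 0 T) = volume (γ ⁻¹' A ∩ Set.Ioc 0 T) := by
    intro A hA
    have e1 : γ ⁻¹' (ψ ⁻¹' A) ∩ Set.Ioc 0 T =
        (fun t => s + t) ⁻¹' (γ ⁻¹' A ∩ Set.Ioc s (s + T)) := by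
      ext t
      simp [h]
    -- The shifted window (s, s + T] and (0, T] are both fundamental domains of the translations by
    -- multiples of T, so they see the same measure of a T-periodic set.
    rw [e1, measure_preimage_add]
    have f1 := isAddFundamentalDomain_Ioc hT s volume
    have f2 := isAddFundamentalDomain_Ioc hT 0 volume
    rw [zero_add] at f2
    refine f1.measure_set_eq f2 (hγ.measurable hA) ?_
    rintro ⟨g, n, rfl⟩
    ext t
    simp only [Set.mem_preimage]
    have : γ (n • T + t) = γ t := by
      rw [add_comm]; exact (hp.zsmul n) t
    rw [show ((⟨(fun x => x • T) n, n, rfl⟩ : AddSubgroup.zmultiples T) +ᵥ t) = n • T + t from rfl,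
      this]
  unfold orbitMeasure
  rw [Measure.map_map hψ hγ.measurable]
  ext A hA
  rw [Measure.map_apply (hψ.comp hγ.measurable) hA, Measure.map_apply hγ.measurable hA,
    Set.preimage_comp, Measure.smul_apply, Measure.smul_apply,
    Measure.restrict_apply (hγ.measurable (hψ hA)), Measure.restrict_apply (hγ.measurable hA),
    hv A hA]

lemma orbitMeasure_mem_invariantMeasures {p₀ q₀ : ℝ} {f : Torus → ℝ} {K : NNReal}
    (hK : LipschitzWith K (liftGrad f)) {φ : ℝ → TangentTorus → TangentTorus}
    (hφ : IsEulerLagrangeFlow (addPotential (exampleLagrangian p₀ q₀) f) φ)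
    (hm : ∀ t, Measurable (φ t)) {γ : ℝ → TangentTorus}
    (hγ : IsOrbit (addPotential (exampleLagrangian p₀ q₀) f) γ) {T : ℝ} (hT : 0 < T)
    (hp : Function.Periodic γ T) :
    orbitMeasure γ T ∈ invariantMeasures (addPotential (exampleLagrangian p₀ q₀) f) := by
  refine ⟨isProbabilityMeasure_orbitMeasure hγ.continuous hT,
    ⟨_, orbitMeasure_compl_image hγ.continuous T⟩, φ, hφ, fun s =>
      measurePreserving_orbitMeasure hγ.continuous hT hp (hm s) (s := s) fun t => ?_⟩
  have := IsOrbit.shift_eq hK (hφ (γ t)).2 hγ (a := 0) (b := t) (hφ (γ t)).1 s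
  simpa [add_comm] using this

end OrbitMeasure

/-! ### Closed trajectories in a potential with small Hessian. -/

/-- The action `∫₀¹ |y'|² / 2 + V(y)` of a curve `y` with velocity `y'`. -/
def unitAction (V : ℝ × ℝ → ℝ) (y y' : ℝ → ℝ × ℝ) : ℝ :=
  ∫ t in (0 : ℝ)..1, (((y' t).1 ^ 2 + (y' t).2 ^ 2) / 2 + V (y t))

/-- A fixed point of ξ ↦ a + tk + Q(t) - tQ(1), where Q is the double primitive of g ∘ ξ. The two Q
terms are each 1/4-Lipschitz in ξ, so the map contracts by 1/2. -/
lemma exists_newton_boundary_value {g : ℝ × ℝ → ℝ × ℝ} (hg : LipschitzWith (1 / 4) g)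
    (a k : ℝ × ℝ) : ∃ z z' : ℝ → ℝ × ℝ, (∀ t, HasDerivAt z (z' t) t) ∧ Continuous z' ∧
      (∀ t ∈ Set.Icc (0 : ℝ) 1, HasDerivAt z' (g (z t)) t) ∧ z 0 = a ∧ z 1 = a + k := by
  let X := C(Set.Icc (0 : ℝ) 1, ℝ × ℝ)
  -- Clamping the time to [0, 1] makes every function below defined on ℝ; the price is that Newton's
  -- equation is obtained on [0, 1] only.
  let G : X → ℝ → ℝ × ℝ := fun ξ s => g (ξ (Set.projIcc 0 1 zero_le_one s))
  have hG : ∀ ξ, Continuous (G ξ) := fun ξ =>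
    hg.continuous.comp (ξ.continuous.comp continuous_projIcc)
  let P : X → ℝ → ℝ × ℝ := fun ξ t => ∫ s in (0 : ℝ)..t, G ξ s
  have hP : ∀ ξ t, HasDerivAt (P ξ) (G ξ t) t := fun ξ t => (hG ξ).integral_hasStrictDerivAt 0 t
    |>.hasDerivAt
  have hPc : ∀ ξ, Continuous (P ξ) := fun ξ =>
    continuous_iff_continuousAt.2 fun t => (hP ξ t).continuousAt
  let Q : X → ℝ → ℝ × ℝ := fun ξ t => ∫ s in (0 : ℝ)..t, P ξ s
  have hQ : ∀ ξ t, HasDerivAt (Q ξ) (P ξ t) t := fun ξ t => (hPc ξ).integral_hasStrictDerivAt 0 t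
    |>.hasDerivAt
  let z : X → ℝ → ℝ × ℝ := fun ξ t => a + (t • k + (Q ξ t - t • Q ξ 1))
  let z' : X → ℝ → ℝ × ℝ := fun ξ t => k + (P ξ t - Q ξ 1)
  have hz : ∀ ξ t, HasDerivAt (z ξ) (z' ξ t) t := by
    intro ξ t
    have := (((hasDerivAt_id t).smul_const k).fun_add ((hQ ξ t).fun_sub
      ((hasDerivAt_id t).smul_const (Q ξ 1)))).const_add a
    simp only [one_smul] at this
    exact this
  have hz' : ∀ ξ t, HasDerivAt (z' ξ) (G ξ t) t := fun ξ t =>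
    ((hP ξ t).sub_const _).const_add _
  have hzc : ∀ ξ, Continuous (z ξ) := fun ξ =>
    continuous_iff_continuousAt.2 fun t => (hz ξ t).continuousAt
  let Φ : X → X := fun ξ => ⟨fun t => z ξ t, (hzc ξ).comp continuous_subtype_val⟩
  have bG : ∀ ξ ζ s, ‖G ξ s - G ζ s‖ ≤ 1 / 4 * dist ξ ζ := by
    intro ξ ζ s
    rw [← dist_eq_norm]
    refine (hg.dist_le_mul _ _).trans ?_
    have := ContinuousMap.dist_apply_le_dist (f := ξ) (g := ζ) (Set.projIcc 0 1 zero_le_one s)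
    simp only [NNReal.coe_div, NNReal.coe_one, NNReal.coe_ofNat]
    linarith
  have bP : ∀ ξ ζ, ∀ t ∈ Set.Icc (0 : ℝ) 1, ‖P ξ t - P ζ t‖ ≤ 1 / 4 * dist ξ ζ := by
    intro ξ ζ t ht
    simp only [P]
    rw [← intervalIntegral.integral_sub ((hG ξ).intervalIntegrable _ _)
      ((hG ζ).intervalIntegrable _ _)]
    refine (intervalIntegral.norm_integral_le_of_norm_le_const fun s _ => bG ξ ζ s).trans ?_
    rw [sub_zero, abs_of_nonneg ht.1]
    exact mul_le_of_le_one_right (by positivity) ht.2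
  have bQ : ∀ ξ ζ, ∀ t ∈ Set.Icc (0 : ℝ) 1, ‖Q ξ t - Q ζ t‖ ≤ 1 / 4 * dist ξ ζ := by
    intro ξ ζ t ht
    simp only [Q]
    rw [← intervalIntegral.integral_sub ((hPc ξ).intervalIntegrable _ _)
      ((hPc ζ).intervalIntegrable _ _)]
    refine (intervalIntegral.norm_integral_le_of_norm_le_const (C := 1 / 4 * dist ξ ζ)
      fun s hs => ?_).trans ?_
    · rw [Set.uIoc_of_le ht.1] at hs
      exact bP ξ ζ s ⟨hs.1.le, hs.2.trans ht.2⟩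
    · rw [sub_zero, abs_of_nonneg ht.1]
      exact mul_le_of_le_one_right (by positivity) ht.2
  have hΦ : ContractingWith (1 / 2) Φ := by
    refine ⟨by rw [← NNReal.coe_lt_coe]; norm_num, LipschitzWith.of_dist_le_mul fun ξ ζ => ?_⟩
    rw [ContinuousMap.dist_le (by positivity)]
    rintro ⟨t, ht⟩
    have e : z ξ t - z ζ t = (Q ξ t - Q ζ t) - t • (Q ξ 1 - Q ζ 1) := by
      simp only [z, smul_sub]; abel
    change dist (z ξ t) (z ζ t) ≤ _
    rw [dist_eq_norm, e]
    refine (norm_sub_le _ _).trans ?_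
    rw [norm_smul, Real.norm_eq_abs, abs_of_nonneg ht.1]
    have h1 := bQ ξ ζ t ht
    have h2 := bQ ξ ζ 1 ⟨zero_le_one, le_rfl⟩
    have h3 := mul_le_of_le_one_left (norm_nonneg (Q ξ 1 - Q ζ 1)) ht.2
    simp only [NNReal.coe_div, NNReal.coe_one, NNReal.coe_ofNat]
    linarith
  let ξ := ContractingWith.fixedPoint Φ hΦ
  have hξ : Φ ξ = ξ := hΦ.fixedPoint_isFixedPt
  refine ⟨z ξ, z' ξ, hz ξ, continuous_iff_continuousAt.2 fun t => (hz' ξ t).continuousAt,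
    fun t ht => ?_, by simp [z, Q], by simp [z]⟩
  have h1 : z ξ t = ξ ⟨t, ht⟩ := DFunLike.congr_fun hξ ⟨t, ht⟩
  have h2 : G ξ t = g (z ξ t) := by
    simp only [G, Set.projIcc_of_mem zero_le_one ht, h1]
  rw [← h2]
  exact hz' ξ t

/-- Mean value inequality for V minus its linear part. Passing from the max norm of gradients to the
dual norm costs a factor 2, whence 2 · 1/4 = 1/2. -/
lemma abs_sub_sub_pairForm_le {V : ℝ × ℝ → ℝ} {g : ℝ × ℝ → ℝ × ℝ}
    (hV : ∀ x, HasFDerivAt V (pairForm (g x)) x) (hg : LipschitzWith (1 / 4) g) (x v : ℝ × ℝ) :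
    |V (x + v) - V x - pairForm (g x) v| ≤ 1 / 2 * (v.1 ^ 2 + v.2 ^ 2) := by
  have hd : ∀ y, HasFDerivAt (fun y => V y - pairForm (g x) y)
      (pairForm (g y) - pairForm (g x)) y := fun y =>
    (hV y).fun_sub (pairForm (g x)).hasFDerivAt
  have hb : ∀ y ∈ Metric.closedBall x ‖v‖, ‖pairForm (g y) - pairForm (g x)‖ ≤ 1 / 2 * ‖v‖ := by
    intro y hy
    refine ContinuousLinearMap.opNorm_le_bound _ (by positivity) fun w => ?_
    have h1 := hg.dist_le_mul y x
    rw [dist_eq_norm] at h1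
    rw [Metric.mem_closedBall] at hy
    have h2 := norm_fst_le (g y - g x)
    have h3 := norm_snd_le (g y - g x)
    have h4 := norm_fst_le w
    have h5 := norm_snd_le w
    have e : (pairForm (g y) - pairForm (g x)) w =
        (g y - g x).1 * w.1 + (g y - g x).2 * w.2 := by
      simp; ring
    simp only [NNReal.coe_div, NNReal.coe_one, NNReal.coe_ofNat] at h1
    rw [e]
    refine (norm_add_le _ _).trans ?_
    rw [norm_mul, norm_mul]
    have h6 : ‖g y - g x‖ ≤ 1 / 4 * ‖v‖ := by linarith
    have := mul_le_mul (h2.trans h6) h4 (norm_nonneg _) (by positivity)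
    have := mul_le_mul (h3.trans h6) h5 (norm_nonneg _) (by positivity)
    linarith
  have := (convex_closedBall x ‖v‖).norm_image_sub_le_of_norm_hasFDerivWithin_le
    (fun y hy => (hd y).hasFDerivWithinAt) hb
    (Metric.mem_closedBall_self (norm_nonneg v)) (y := x + v) (by simp)
  rw [Real.norm_eq_abs] at this
  have e : V (x + v) - pairForm (g x) (x + v) - (V x - pairForm (g x) x) =
      V (x + v) - V x - pairForm (g x) v := by
    rw [map_add]; ring
  rw [e] at this
  refine this.trans ?_
  rw [add_sub_cancel_left, mul_assoc, ← sq]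
  gcongr
  rw [Prod.norm_def]
  rcases max_choice ‖v.1‖ ‖v.2‖ with h | h <;> rw [h, Real.norm_eq_abs, sq_abs] <;> nlinarith

/-- A Poincaré inequality with the crude constant 1, obtained from Cauchy-Schwarz on [0, t]. -/
lemma integral_sq_le_integral_deriv_sq {u u' : ℝ → ℝ} (hu : ∀ t, HasDerivAt u (u' t) t)
    (hu' : Continuous u') (h0 : u 0 = 0) :
    ∫ t in (0 : ℝ)..1, u t ^ 2 ≤ ∫ t in (0 : ℝ)..1, u' t ^ 2 := by
  have huc : Continuous u := continuous_iff_continuousAt.2 fun t => (hu t).continuousAt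
  have key : ∀ t ∈ Set.Icc (0 : ℝ) 1, u t ^ 2 ≤ ∫ t in (0 : ℝ)..1, u' t ^ 2 := by
    intro t ht
    have h1 : ∫ s in (0 : ℝ)..t, u' s = u t := by
      rw [intervalIntegral.integral_eq_sub_of_hasDerivAt (fun s _ => hu s)
        (hu'.intervalIntegrable _ _), h0, sub_zero]
    have h2 : 0 ≤ ∫ s in (0 : ℝ)..t, (u' s - u t) ^ 2 :=
      intervalIntegral.integral_nonneg ht.1 fun s _ => sq_nonneg _
    have h3 : ∫ s in (0 : ℝ)..t, (u' s - u t) ^ 2 =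
        (∫ s in (0 : ℝ)..t, u' s ^ 2) - 2 * u t * u t + t * u t ^ 2 := by
      have : ∀ s, (u' s - u t) ^ 2 = u' s ^ 2 - 2 * u t * u' s + u t ^ 2 := fun s => by ring
      simp only [this]
      rw [intervalIntegral.integral_add, intervalIntegral.integral_sub,
        intervalIntegral.integral_const_mul, h1, intervalIntegral.integral_const]
      · simp
      all_goals exact Continuous.intervalIntegrable (by fun_prop) _ _
    have h4 : ∫ s in (0 : ℝ)..t, u' s ^ 2 ≤ ∫ s in (0 : ℝ)..1, u' s ^ 2 := by
      refine intervalIntegral.integral_mono_interval le_rfl ht.1 ht.2 ?_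
        ((hu'.pow 2).intervalIntegrable _ _)
      exact Filter.Eventually.of_forall fun s => sq_nonneg _
    have h5 := mul_le_of_le_one_left (sq_nonneg (u t)) ht.2
    nlinarith
  calc ∫ t in (0 : ℝ)..1, u t ^ 2 ≤ ∫ _t in (0 : ℝ)..1, ∫ t in (0 : ℝ)..1, u' t ^ 2 :=
        intervalIntegral.integral_mono_on zero_le_one ((huc.pow 2).intervalIntegrable _ _)
          (by simp) key
    _ = _ := by simp

/-- The action is convex for fixed endpoints: with e = y - z, the first variation integrates to
zero, and the kinetic gain ∫|e'|²/2 dominates the potential loss, at most ∫|e|²/2, by Poincaré. -/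
lemma unitAction_le {V : ℝ × ℝ → ℝ} {g : ℝ × ℝ → ℝ × ℝ}
    (hV : ∀ x, HasFDerivAt V (pairForm (g x)) x) (hg : LipschitzWith (1 / 4) g)
    {z z' y y' : ℝ → ℝ × ℝ} (hz : ∀ t, HasDerivAt z (z' t) t) (hzc : Continuous z')
    (hz' : ∀ t ∈ Set.Icc (0 : ℝ) 1, HasDerivAt z' (g (z t)) t)
    (hy : ∀ t, HasDerivAt y (y' t) t) (hyc : Continuous y') (h0 : y 0 = z 0) (h1 : y 1 = z 1) :
    unitAction V z z' ≤ unitAction V y y' := by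
  have cV : Continuous V := continuous_iff_continuousAt.2 fun x => (hV x).continuousAt
  have cz : Continuous z := continuous_iff_continuousAt.2 fun x => (hz x).continuousAt
  have cy : Continuous y := continuous_iff_continuousAt.2 fun x => (hy x).continuousAt
  have cg := hg.continuous
  let e : ℝ → ℝ × ℝ := fun t => y t - z t
  let e' : ℝ → ℝ × ℝ := fun t => y' t - z' t
  have he : ∀ t, HasDerivAt e (e' t) t := fun t => (hy t).fun_sub (hz t)
  have ce : Continuous e := cy.sub cz
  have ce' : Continuous e' := hyc.sub hzc
  have e0 : e 0 = 0 := by simp [e, h0]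
  have e1 : e 1 = 0 := by simp [e, h1]
  let A : ℝ → ℝ := fun t => ((g (z t)).1 * (e t).1 + (z' t).1 * (e' t).1) +
    ((g (z t)).2 * (e t).2 + (z' t).2 * (e' t).2)
  have hA : ∫ t in (0 : ℝ)..1, A t = 0 := by
    have : ∀ t ∈ Set.uIcc (0 : ℝ) 1, HasDerivAt
        (fun t => (z' t).1 * (e t).1 + (z' t).2 * (e t).2) (A t) t := by
      intro t ht
      rw [Set.uIcc_of_le zero_le_one] at ht
      exact ((hz' t ht).fst.fun_mul (he t).fst).fun_add ((hz' t ht).snd.fun_mul (he t).snd)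
    rw [intervalIntegral.integral_eq_sub_of_hasDerivAt this
      (Continuous.intervalIntegrable (by fun_prop) _ _), e0, e1]
    simp
  have p1 := integral_sq_le_integral_deriv_sq (fun t => (he t).fst) ce'.fst (by simp [e0])
  have p2 := integral_sq_le_integral_deriv_sq (fun t => (he t).snd) ce'.snd (by simp [e0])
  have key : ∀ t, (((z' t).1 ^ 2 + (z' t).2 ^ 2) / 2 + V (z t)) + A t +
      (1 / 2 : ℝ) * (((e' t).1 ^ 2 - (e t).1 ^ 2) + ((e' t).2 ^ 2 - (e t).2 ^ 2)) ≤
      ((y' t).1 ^ 2 + (y' t).2 ^ 2) / 2 + V (y t) := by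
    intro t
    have h := (abs_le.1 (abs_sub_sub_pairForm_le hV hg (z t) (e t))).1
    have hy1 : z t + e t = y t := by simp [e]
    have hy2 : y' t = z' t + e' t := by simp [e']
    rw [hy1, pairForm_apply] at h
    rw [hy2]
    simp only [A, Prod.fst_add, Prod.snd_add]
    nlinarith
  have i0 : 0 ≤ ∫ t in (0 : ℝ)..1,
      (1 / 2 : ℝ) * (((e' t).1 ^ 2 - (e t).1 ^ 2) + ((e' t).2 ^ 2 - (e t).2 ^ 2)) := by
    rw [intervalIntegral.integral_const_mul, intervalIntegral.integral_add,
      intervalIntegral.integral_sub, intervalIntegral.integral_sub]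
    · linarith
    all_goals exact Continuous.intervalIntegrable (by fun_prop) _ _
  unfold unitAction
  have i1 := intervalIntegral.integral_mono (μ := volume) zero_le_one
    (Continuous.intervalIntegrable (by fun_prop) _ _)
    (Continuous.intervalIntegrable (by fun_prop) _ _) key
  rw [intervalIntegral.integral_add, intervalIntegral.integral_add, hA] at i1
  · linarith
  all_goals exact Continuous.intervalIntegrable (by fun_prop) _ _

lemma exists_intVec_add_mem_Icc (x : ℝ × ℝ) :
    ∃ m : ℤ × ℤ, x + intVec m ∈ Set.Icc (0 : ℝ × ℝ) 1 := by
  refine ⟨(-⌊x.1⌋, -⌊x.2⌋), ?_, ?_⟩ <;> rw [Prod.le_def] <;>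
    simp only [Prod.fst_zero, Prod.snd_zero, Prod.fst_one, Prod.snd_one, Prod.fst_add,
      Prod.snd_add, intVec_fst, intVec_snd, Int.cast_neg]
  · exact ⟨by linarith [Int.floor_le x.1], by linarith [Int.floor_le x.2]⟩
  · exact ⟨by linarith [Int.lt_floor_add_one x.1], by linarith [Int.lt_floor_add_one x.2]⟩

/-- A periodic potential with a small gradient has closed trajectories in each homotopy class, whose
action is at most that of each straight line. -/
theorem exists_closed_newton {V : ℝ × ℝ → ℝ} {g : ℝ × ℝ → ℝ × ℝ}
    (hV : ∀ x, HasFDerivAt V (pairForm (g x)) x) (hg : LipschitzWith (1 / 4) g)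
    {K : NNReal} (hK : LipschitzWith K V) (hp : ∀ x m, V (x + intVec m) = V x) (k : ℝ × ℝ) :
    ∃ z z' : ℝ → ℝ × ℝ, (∀ t, HasDerivAt z (z' t) t) ∧ Continuous z' ∧
      (∀ t ∈ Set.Icc (0 : ℝ) 1, HasDerivAt z' (g (z t)) t) ∧ z 1 = z 0 + k ∧ z' 1 = z' 0 ∧
      ∀ a, unitAction V z z' ≤ unitAction V (fun t => a + t • k) (fun _ => k) := by
  choose z z' hz hzc hz' h0 h1 using fun a => exists_newton_boundary_value hg a k
  have cV := hK.continuous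
  have cz : ∀ a, Continuous (z a) := fun a =>
    continuous_iff_continuousAt.2 fun x => (hz a x).continuousAt
  -- S(a) is the least action from a to a + k. Translating the curve of a by v gives a competitor
  -- for a + v with the same kinetic energy; this one comparison yields the continuity of S, its
  -- periodicity and its first variation.
  let S : ℝ × ℝ → ℝ := fun a => unitAction V (z a) (z' a)
  have hS : ∀ a v, S (a + v) ≤ unitAction V (fun t => z a t + v) (z' a) := fun a v =>
    unitAction_le hV hg (hz _) (hzc _) (hz' _) (fun t => (hz a t).add_const v) (hzc a)
      (by simp [h0]) (by simp [h1]; abel)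
  have hmono : ∀ a v (b : ℝ → ℝ), Continuous b → (∀ t, V (z a t + v) ≤ V (z a t) + b t) →
      S (a + v) ≤ S a + ∫ t in (0 : ℝ)..1, b t := by
    intro a v b hb h
    refine (hS a v).trans ?_
    simp only [S, unitAction]
    have := hzc a
    have := cz a
    rw [← intervalIntegral.integral_add]
    · refine intervalIntegral.integral_mono (μ := volume) zero_le_one
        (Continuous.intervalIntegrable (by fun_prop) _ _)
        (Continuous.intervalIntegrable (by fun_prop) _ _) fun t => ?_
      have := h t
      simp only
      linarith
    all_goals exact Continuous.intervalIntegrable (by fun_prop) _ _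
  have cS : Continuous S := by
    refine (LipschitzWith.of_le_add_mul K fun x y => ?_).continuous
    have := hmono y (x - y) (fun _ => K * dist x y) continuous_const fun t => by
      have := hK.dist_le_mul (z y t + (x - y)) (z y t)
      rw [dist_eq_norm (z y t + (x - y)), add_sub_cancel_left, Real.dist_eq, ← dist_eq_norm] at this
      linarith [(abs_le.1 this).2]
    simpa using this
  obtain ⟨a, -, ha⟩ := isCompact_Icc.exists_isMinOn (s := Set.Icc (0 : ℝ × ℝ) 1)
    ⟨0, le_rfl, zero_le_one⟩ cS.continuousOn
  have hmin : ∀ x, S a ≤ S x := by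
    intro x
    obtain ⟨m, hm⟩ := exists_intVec_add_mem_Icc x
    refine (isMinOn_iff.1 ha _ hm).trans ?_
    have := hmono x (intVec m) 0 continuous_zero fun t => by simp [hp]
    simpa using this
  have cza := cz a
  have cg' := hg.continuous
  have cg : Continuous fun t => g (z a t) := cg'.comp cza
  have i1 : ∫ t in (0 : ℝ)..1, (g (z a t)).1 = (z' a 1).1 - (z' a 0).1 :=
    intervalIntegral.integral_eq_sub_of_hasDerivAt (fun t ht => (hz' a t (by
      rwa [Set.uIcc_of_le zero_le_one] at ht)).fst) (cg.fst.intervalIntegrable _ _)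
  have i2 : ∫ t in (0 : ℝ)..1, (g (z a t)).2 = (z' a 1).2 - (z' a 0).2 :=
    intervalIntegral.integral_eq_sub_of_hasDerivAt (fun t ht => (hz' a t (by
      rwa [Set.uIcc_of_le zero_le_one] at ht)).snd) (cg.snd.intervalIntegrable _ _)
  -- The velocity jump I equals the integrated force. Moving the minimum a by -I would change S by
  -- at most -|I|² + |I|²/2, so I = 0.
  have hI : z' a 1 = z' a 0 := by
    set I := z' a 1 - z' a 0 with hI
    have h2 := hmono a (-I) (fun t => (g (z a t)).1 * (-I.1) + (g (z a t)).2 * (-I.2) +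
      1 / 2 * (I.1 ^ 2 + I.2 ^ 2)) (by fun_prop) fun t => by
        have := (abs_le.1 (abs_sub_sub_pairForm_le hV hg (z a t) (-I))).2
        simp only [pairForm_apply, Prod.fst_neg, Prod.snd_neg] at this
        linarith
    rw [intervalIntegral.integral_add, intervalIntegral.integral_add,
      intervalIntegral.integral_mul_const, intervalIntegral.integral_mul_const, i1, i2,
      ← Prod.fst_sub, ← Prod.snd_sub, ← hI] at h2
    · simp only [intervalIntegral.integral_const, sub_zero, one_smul] at h2
      have h3 := hmin (a + -I)
      have h4 : I.1 ^ 2 + I.2 ^ 2 ≤ 0 := by nlinarith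
      have h5 : I.1 = 0 := by nlinarith [sq_nonneg I.1, sq_nonneg I.2]
      have h6 : I.2 = 0 := by nlinarith [sq_nonneg I.1, sq_nonneg I.2]
      exact sub_eq_zero.1 (Prod.ext h5 h6)
    all_goals exact Continuous.intervalIntegrable (by fun_prop) _ _
  refine ⟨z a, z' a, hz a, hzc a, hz' a, by rw [h0, h1], hI, fun b => (hmin b).trans ?_⟩
  refine unitAction_le hV hg (hz b) (hzc b) (hz' b) (fun t => ?_) continuous_const
    (by simp [h0]) (by simp [h1])
  simpa using ((hasDerivAt_id t).smul_const k).const_add b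

/-! ### Functions critical along equally spaced parallel lines. -/

section Estimates

set_option maxSynthPendingDepth 10

section CNorm

variable {f : Torus → ℝ}

lemma norm_iteratedFDeriv_le_torusCNorm {n : ℕ} (hf : TorusContDiff n f) {k : ℕ} (hk : k ≤ n)
    (x : ℝ × ℝ) :
    ‖iteratedFDeriv ℝ k (fun y : ℝ × ℝ => f (torusProj y)) x‖ ≤ torusCNorm n f := by
  -- An unbounded real supremum would default to 0, so boundedness is needed; it follows from
  -- compactness of the unit cell.
  have hbdd : ∀ k : Fin (n + 1), BddAbove (Set.range fun x : ℝ × ℝ =>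
      ‖iteratedFDeriv ℝ (k : ℕ) (fun y : ℝ × ℝ => f (torusProj y)) x‖) := by
    intro k
    have hc : Continuous fun x : ℝ × ℝ =>
        ‖iteratedFDeriv ℝ (k : ℕ) (fun y : ℝ × ℝ => f (torusProj y)) x‖ :=
      (ContDiff.continuous_iteratedFDeriv (by exact_mod_cast Nat.lt_succ_iff.1 k.2) hf).norm
    obtain ⟨C, hC⟩ := (isCompact_Icc (a := (0 : ℝ × ℝ)) (b := 1)).bddAbove_image hc.continuousOn
    refine ⟨C, ?_⟩
    rintro _ ⟨x, rfl⟩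
    obtain ⟨m, hm⟩ := exists_intVec_add_mem_Icc x
    have h := iteratedFDeriv_comp_add_right (𝕜 := ℝ) (f := fun y : ℝ × ℝ => f (torusProj y))
      (k : ℕ) (intVec m) x
    simp only [torusProj_add_intVec] at h
    simp only [h]
    exact hC ⟨_, hm, rfl⟩
  have h1 := le_ciSup (hbdd ⟨k, Nat.lt_succ_iff.2 hk⟩) x
  exact h1.trans (le_ciSup (f := fun k : Fin (n + 1) => ⨆ x : ℝ × ℝ,
    ‖iteratedFDeriv ℝ (k : ℕ) (fun y : ℝ × ℝ => f (torusProj y)) x‖)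
    (Set.finite_range _).bddAbove ⟨k, Nat.lt_succ_iff.2 hk⟩)

lemma abs_le_torusCNorm {n : ℕ} (hf : TorusContDiff n f) (x : ℝ × ℝ) :
    |f (torusProj x)| ≤ torusCNorm n f := by
  simpa using norm_iteratedFDeriv_le_torusCNorm hf (Nat.zero_le n) x

lemma norm_fderiv_le_torusCNorm (hf : TorusContDiff 4 f) (x : ℝ × ℝ) :
    ‖fderiv ℝ (fun y : ℝ × ℝ => f (torusProj y)) x‖ ≤ torusCNorm 4 f := by
  have := norm_iteratedFDeriv_le_torusCNorm hf (show 1 ≤ 4 by norm_num) x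
  simpa [← norm_iteratedFDeriv_fderiv] using this

lemma norm_fderiv_two_le_torusCNorm (hf : TorusContDiff 4 f) (x : ℝ × ℝ) :
    ‖fderiv ℝ (fderiv ℝ (fun y : ℝ × ℝ => f (torusProj y))) x‖ ≤ torusCNorm 4 f := by
  have := norm_iteratedFDeriv_le_torusCNorm hf (show 2 ≤ 4 by norm_num) x
  simpa [← norm_iteratedFDeriv_fderiv] using this

lemma norm_fderiv_four_le_torusCNorm (hf : TorusContDiff 4 f) (x : ℝ × ℝ) :
    ‖fderiv ℝ (fderiv ℝ (fderiv ℝ (fderiv ℝ (fun y : ℝ × ℝ => f (torusProj y))))) x‖ ≤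
      torusCNorm 4 f := by
  have := norm_iteratedFDeriv_le_torusCNorm hf le_rfl x
  simpa [← norm_iteratedFDeriv_fderiv] using this

end CNorm

section Rolle

lemma abs_le_of_exists_zero {u u' : ℝ → ℝ} (hu : ∀ s, HasDerivAt u (u' s) s) {B d : ℝ}
    (hB : ∀ s, |u' s| ≤ B) {s c : ℝ} (hc : u c = 0) (hd : |s - c| ≤ d) : |u s| ≤ d * B := by
  have := convex_univ.norm_image_sub_le_of_norm_hasDerivWithin_le
    (fun x _ => (hu x).hasDerivWithinAt) (fun x _ => hB x) (Set.mem_univ c) (Set.mem_univ s)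
  rw [hc, sub_zero, Real.norm_eq_abs, Real.norm_eq_abs] at this
  refine this.trans ?_
  rw [mul_comm d]
  exact mul_le_mul_of_nonneg_left hd ((abs_nonneg _).trans (hB c))

lemma exists_deriv_zero_Ioo {u u' : ℝ → ℝ} (hu : ∀ s, HasDerivAt u (u' s) s) {a b : ℝ}
    (hab : a < b) (ha : u a = 0) (hb : u b = 0) : ∃ c ∈ Set.Ioo a b, u' c = 0 :=
  exists_hasDerivAt_eq_zero hab (continuous_iff_continuousAt.2 fun s => (hu s).continuousAt).continuousOn
    (ha.trans hb.symm) fun s _ => hu s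

lemma exists_deriv_zero_of_int {u u' : ℝ → ℝ} (hu : ∀ s, HasDerivAt u (u' s) s)
    (h0 : ∀ j : ℤ, u j = 0) (j : ℤ) : ∃ c ∈ Set.Ioo (j : ℝ) (j + 1), u' c = 0 :=
  exists_deriv_zero_Ioo hu (by linarith) (h0 j) (by simpa using h0 (j + 1))

/-- By Rolle every unit interval contains a zero of u'. Integrating twice, each time from a zero at
distance at most 1, loses no constant. -/
lemma abs_le_of_int_zeros {u u' u'' : ℝ → ℝ} (hu : ∀ s, HasDerivAt u (u' s) s)
    (hu' : ∀ s, HasDerivAt u' (u'' s) s) (h0 : ∀ j : ℤ, u j = 0) {B : ℝ} (hB : ∀ s, |u'' s| ≤ B)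
    (s : ℝ) : |u s| ≤ B := by
  have h1 : ∀ s, |u' s| ≤ B := by
    intro s
    obtain ⟨c, hc, hc0⟩ := exists_deriv_zero_of_int hu h0 ⌊s⌋
    have := abs_le_of_exists_zero hu' hB (s := s) (d := 1) hc0 (abs_le.2
      ⟨by linarith [Int.floor_le s, hc.2], by linarith [Int.lt_floor_add_one s, hc.1]⟩)
    simpa using this
  have := abs_le_of_exists_zero hu h1 (s := s) (d := 1) (h0 ⌊s⌋) (abs_le.2
      ⟨by linarith [Int.floor_le s], by linarith [Int.lt_floor_add_one s]⟩)
  simpa using this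

/-- Zeros of u' in two consecutive unit intervals enclose a zero of u'', which is at distance at
most 2: hence the factor 2. -/
lemma abs_deriv_le_of_int_zeros {u u' u'' u''' : ℝ → ℝ} (hu : ∀ s, HasDerivAt u (u' s) s)
    (hu' : ∀ s, HasDerivAt u' (u'' s) s) (hu'' : ∀ s, HasDerivAt u'' (u''' s) s)
    (h0 : ∀ j : ℤ, u j = 0) {B : ℝ} (hB : ∀ s, |u''' s| ≤ B) (s : ℝ) : |u' s| ≤ 2 * B := by
  have h1 : ∀ s, |u'' s| ≤ 2 * B := by
    intro s
    obtain ⟨c, hc, hc0⟩ := exists_deriv_zero_of_int hu h0 ⌊s⌋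
    obtain ⟨c', hc', hc0'⟩ := exists_deriv_zero_of_int hu h0 (⌊s⌋ + 1)
    push_cast at hc'
    obtain ⟨d, hd, hd0⟩ := exists_deriv_zero_Ioo hu' (hc.2.trans hc'.1) hc0 hc0'
    exact abs_le_of_exists_zero hu'' hB hd0 (abs_le.2
      ⟨by linarith [Int.floor_le s, hd.2, hc'.2],
        by linarith [Int.lt_floor_add_one s, hd.1, hc.1]⟩)
  obtain ⟨c, hc, hc0⟩ := exists_deriv_zero_of_int hu h0 ⌊s⌋
  have := abs_le_of_exists_zero hu' h1 (s := s) (d := 1) hc0 (abs_le.2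
      ⟨by linarith [Int.floor_le s, hc.2], by linarith [Int.lt_floor_add_one s, hc.1]⟩)
  simpa using this

end Rolle

lemma hasDerivAt_comp_line {W : Type*} [NormedAddCommGroup W] [NormedSpace ℝ W]
    {A : ℝ × ℝ → W} {n : ℕ} (hn : n ≠ 0) (hA : ContDiff ℝ n A) (y v : ℝ × ℝ) (s : ℝ) :
    HasDerivAt (fun s : ℝ => A (y + s • v)) (fderiv ℝ A (y + s • v) v) s := by
  have h1 : HasDerivAt (fun s : ℝ => y + s • v) v s := by
    simpa using ((hasDerivAt_id s).smul_const v).const_add y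
  exact ((hA.differentiable (by simpa using hn)) (y + s • v)).hasFDerivAt.comp_hasDerivAt s h1

lemma abs_apply_two_le (B : ℝ × ℝ →L[ℝ] ℝ × ℝ →L[ℝ] ℝ) (u v : ℝ × ℝ) :
    |B u v| ≤ ‖B‖ * ‖u‖ * ‖v‖ := B.le_opNorm₂ u v

/-- If the differential of `F` vanishes on equally spaced parallel lines, then the Hessian of `F` is
controlled by its fourth differential and the square of the spacing. -/
theorem hessian_estimates {F : ℝ × ℝ → ℝ} (hF : ContDiff ℝ 4 F) {ε : ℝ}
    (hε : ∀ x, ‖fderiv ℝ (fderiv ℝ (fderiv ℝ (fderiv ℝ F))) x‖ ≤ ε) {x₀ m : ℝ × ℝ} {h a : ℝ}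
    (h0 : 0 < h) (hh : h ^ 2 * (m.1 ^ 2 + m.2 ^ 2) = 1)
    (hd : ∀ (t : ℝ) (j : ℤ),
      fderiv ℝ F (x₀ + t • m + (j : ℝ) • (-m.2 * h ^ 2, m.1 * h ^ 2)) = 0)
    (ha : ∀ (t : ℝ) (j : ℤ), F (x₀ + t • m + (j : ℝ) • (-m.2 * h ^ 2, m.1 * h ^ 2)) = a) :
    (∀ y, ‖fderiv ℝ (fderiv ℝ F) y‖ ≤ 6 * ε * h ^ 2) ∧ ∀ y, |F y - a| ≤ 6 * ε * h ^ 4 := by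
  have hε0 : 0 ≤ ε := (norm_nonneg _).trans (hε 0)
  -- The normal step from one line to the next, of Euclidean length h; along n the lines sit at
  -- integer parameters.
  set n : ℝ × ℝ := (-m.2 * h ^ 2, m.1 * h ^ 2) with hn
  have c1 : ContDiff ℝ (3 : ℕ) (fderiv ℝ F) := hF.fderiv_right (by norm_num)
  have c2 : ContDiff ℝ (2 : ℕ) (fderiv ℝ (fderiv ℝ F)) := c1.fderiv_right (by norm_num)
  have c3 : ContDiff ℝ (1 : ℕ) (fderiv ℝ (fderiv ℝ (fderiv ℝ F))) := c2.fderiv_right (by norm_num)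
  have c0 : ContDiff ℝ (4 : ℕ) F := hF
  have hsplit : ∀ v : ℝ × ℝ,
      v = ((v.1 * m.1 + v.2 * m.2) * h ^ 2) • m + (-v.1 * m.2 + v.2 * m.1) • n := by
    intro v
    have e1 : v.1 = v.1 * (h ^ 2 * (m.1 ^ 2 + m.2 ^ 2)) := by rw [hh, mul_one]
    have e2 : v.2 = v.2 * (h ^ 2 * (m.1 ^ 2 + m.2 ^ 2)) := by rw [hh, mul_one]
    ext
    · simp only [hn, Prod.fst_add, Prod.smul_fst, smul_eq_mul]; linear_combination e1
    · simp only [hn, Prod.snd_add, Prod.smul_snd, smul_eq_mul]; linear_combination e2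
  have hpt : ∀ y, ∃ t s : ℝ, y = x₀ + t • m + s • n := fun y =>
    ⟨_, _, by rw [add_assoc, ← hsplit (y - x₀)]; abel⟩
  have hm1 : |m.1| * h ≤ 1 := by
    refine (sq_le_one_iff₀ (by positivity)).1 ?_
    rw [mul_pow, sq_abs]
    nlinarith [mul_nonneg (sq_nonneg h) (sq_nonneg m.2)]
  have hm2 : |m.2| * h ≤ 1 := by
    refine (sq_le_one_iff₀ (by positivity)).1 ?_
    rw [mul_pow, sq_abs]
    nlinarith [mul_nonneg (sq_nonneg h) (sq_nonneg m.1)]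
  have bm : ‖m‖ * h ≤ 1 := by
    rw [Prod.norm_def]
    rcases max_choice ‖m.1‖ ‖m.2‖ with h' | h' <;> rw [h', Real.norm_eq_abs] <;> assumption
  have bn : ‖n‖ ≤ h := by
    rw [Prod.norm_def]
    simp only [hn, Real.norm_eq_abs, abs_mul, abs_neg, abs_of_pos (pow_pos h0 2)]
    refine max_le ?_ ?_
    · nlinarith [mul_le_mul_of_nonneg_right hm2 h0.le]
    · nlinarith [mul_le_mul_of_nonneg_right hm1 h0.le]
  -- the second differential in the transverse direction
  have A2n : ∀ y e, |fderiv ℝ (fderiv ℝ F) y n e| ≤ 2 * (ε * h ^ 3 * ‖e‖) := by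
    intro y e
    obtain ⟨t, s, rfl⟩ := hpt y
    refine abs_deriv_le_of_int_zeros (u := fun s => fderiv ℝ F (x₀ + t • m + s • n) e)
      (u' := fun s => fderiv ℝ (fderiv ℝ F) (x₀ + t • m + s • n) n e)
      (u'' := fun s => fderiv ℝ (fderiv ℝ (fderiv ℝ F)) (x₀ + t • m + s • n) n n e)
      (u''' := fun s => fderiv ℝ (fderiv ℝ (fderiv ℝ (fderiv ℝ F))) (x₀ + t • m + s • n) n n n e)
      (fun s => ?_) (fun s => ?_) (fun s => ?_) (fun j => by simp [hd]) (fun s => ?_) s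
    · simpa using (hasDerivAt_comp_line (by norm_num) c1 (x₀ + t • m) n s).clm_apply
        (hasDerivAt_const s e)
    · simpa using ((hasDerivAt_comp_line (by norm_num) c2 (x₀ + t • m) n s).clm_apply
        (hasDerivAt_const s n)).clm_apply (hasDerivAt_const s e)
    · simpa using (((hasDerivAt_comp_line (by norm_num) c3 (x₀ + t • m) n s).clm_apply
        (hasDerivAt_const s n)).clm_apply (hasDerivAt_const s n)).clm_apply (hasDerivAt_const s e)
    · refine (abs_apply_two_le _ n e).trans ?_
      have i1 := ContinuousLinearMap.le_opNorm₂
        (fderiv ℝ (fderiv ℝ (fderiv ℝ (fderiv ℝ F))) (x₀ + t • m + s • n)) n n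
      have i2 : ‖fderiv ℝ (fderiv ℝ (fderiv ℝ (fderiv ℝ F))) (x₀ + t • m + s • n)‖ * ‖n‖ * ‖n‖ ≤
          ε * h * h := by
        gcongr
        exact hε _
      calc _ ≤ (ε * h * h) * h * ‖e‖ := by
            gcongr
            exact i1.trans i2
        _ = _ := by ring
  -- With one slot along m, the second differential itself vanishes on the lines, since dF is
  -- constant along each; two transverse derivatives then suffice.
  have A2m : ∀ y e, |fderiv ℝ (fderiv ℝ F) y m e| ≤ ε * h ^ 2 * ‖m‖ * ‖e‖ := by
    intro y e
    obtain ⟨t, s, rfl⟩ := hpt y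
    refine abs_le_of_int_zeros
      (u := fun s => fderiv ℝ (fderiv ℝ F) (x₀ + t • m + s • n) m e)
      (u' := fun s => fderiv ℝ (fderiv ℝ (fderiv ℝ F)) (x₀ + t • m + s • n) n m e)
      (u'' := fun s => fderiv ℝ (fderiv ℝ (fderiv ℝ (fderiv ℝ F))) (x₀ + t • m + s • n) n n m e)
      (fun s => ?_) (fun s => ?_) (fun j => ?_) (fun s => ?_) s
    · simpa using ((hasDerivAt_comp_line (by norm_num) c2 (x₀ + t • m) n s).clm_apply
        (hasDerivAt_const s m)).clm_apply (hasDerivAt_const s e)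
    · simpa using (((hasDerivAt_comp_line (by norm_num) c3 (x₀ + t • m) n s).clm_apply
        (hasDerivAt_const s n)).clm_apply (hasDerivAt_const s m)).clm_apply (hasDerivAt_const s e)
    · have i1 := (hasDerivAt_comp_line (by norm_num) c1 (x₀ + (j : ℝ) • n) m t).clm_apply
        (hasDerivAt_const t e)
      have i2 : (fun t : ℝ => fderiv ℝ F (x₀ + (j : ℝ) • n + t • m) e) = fun _ => 0 := by
        funext t
        rw [add_right_comm, hd]
        simp
      rw [i2] at i1
      have := i1.unique (hasDerivAt_const t (0 : ℝ))
      simpa [add_right_comm] using this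
    · refine (abs_apply_two_le _ m e).trans ?_
      have i1 := ContinuousLinearMap.le_opNorm₂
        (fderiv ℝ (fderiv ℝ (fderiv ℝ (fderiv ℝ F))) (x₀ + t • m + s • n)) n n
      have i2 : ‖fderiv ℝ (fderiv ℝ (fderiv ℝ (fderiv ℝ F))) (x₀ + t • m + s • n)‖ * ‖n‖ * ‖n‖ ≤
          ε * h * h := by
        gcongr
        exact hε _
      calc _ ≤ (ε * h * h) * ‖m‖ * ‖e‖ := by
            gcongr
            exact i1.trans i2
        _ = _ := by ring
  -- Splitting v along m and n gives 2 from the m part and 2 · 2 from the n part.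
  have hA2 : ∀ y, ‖fderiv ℝ (fderiv ℝ F) y‖ ≤ 6 * ε * h ^ 2 := by
    intro y
    refine ContinuousLinearMap.opNorm_le_bound₂ _ (by positivity) fun v e => ?_
    have v1 : |v.1| ≤ ‖v‖ := norm_fst_le v
    have v2 : |v.2| ≤ ‖v‖ := norm_snd_le v
    have b1 : |(v.1 * m.1 + v.2 * m.2) * h ^ 2| ≤ 2 * ‖v‖ * h := by
      rw [abs_mul, abs_of_pos (pow_pos h0 2), sq, ← mul_assoc]
      refine mul_le_mul_of_nonneg_right ?_ h0.le
      calc |v.1 * m.1 + v.2 * m.2| * h ≤ (|v.1| * |m.1| + |v.2| * |m.2|) * h := by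
            gcongr
            rw [← abs_mul, ← abs_mul]
            exact abs_add_le _ _
        _ = |v.1| * (|m.1| * h) + |v.2| * (|m.2| * h) := by ring
        _ ≤ ‖v‖ * 1 + ‖v‖ * 1 := by gcongr
        _ = 2 * ‖v‖ := by ring
    have b2 : |(-v.1 * m.2 + v.2 * m.1)| * h ≤ 2 * ‖v‖ := by
      calc |(-v.1 * m.2 + v.2 * m.1)| * h ≤ (|v.1| * |m.2| + |v.2| * |m.1|) * h := by
            gcongr
            rw [← abs_neg v.1, ← abs_mul, ← abs_mul]
            exact abs_add_le _ _
        _ = |v.1| * (|m.2| * h) + |v.2| * (|m.1| * h) := by ring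
        _ ≤ ‖v‖ * 1 + ‖v‖ * 1 := by gcongr
        _ = 2 * ‖v‖ := by ring
    conv_lhs => rw [hsplit v]
    rw [map_add, map_smul, map_smul, add_apply, smul_apply, smul_apply]
    refine (norm_add_le _ _).trans ?_
    rw [norm_smul, norm_smul]
    calc _ ≤ (2 * ‖v‖ * h) * (ε * h ^ 2 * ‖m‖ * ‖e‖) +
          |(-v.1 * m.2 + v.2 * m.1)| * (2 * (ε * h ^ 3 * ‖e‖)) :=
          add_le_add (mul_le_mul b1 (A2m y e) (abs_nonneg _) (by positivity))
            (mul_le_mul_of_nonneg_left (A2n y e) (abs_nonneg _))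
      _ = 2 * ‖v‖ * ε * h ^ 2 * ‖e‖ * (‖m‖ * h) +
          (|(-v.1 * m.2 + v.2 * m.1)| * h) * (2 * (ε * h ^ 2 * ‖e‖)) := by ring
      _ ≤ 2 * ‖v‖ * ε * h ^ 2 * ‖e‖ * 1 + (2 * ‖v‖) * (2 * (ε * h ^ 2 * ‖e‖)) := by gcongr
      _ = _ := by ring
  refine ⟨hA2, fun y => ?_⟩
  obtain ⟨t, s, rfl⟩ := hpt y
  have u1 := fun s => (hasDerivAt_comp_line (by norm_num) c0 (x₀ + t • m) n s).sub_const a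
  have u2 := fun s => (hasDerivAt_comp_line (by norm_num) c1 (x₀ + t • m) n s).clm_apply
    (hasDerivAt_const s n)
  refine abs_le_of_int_zeros u1 u2 (fun j => by simp [ha]) (fun s => ?_) s
  simp only [map_zero, add_zero]
  refine (abs_apply_two_le _ n n).trans ?_
  calc _ ≤ 6 * ε * h ^ 2 * h * h := by
        gcongr
        exact hA2 _
    _ = _ := by ring

/-- Bézout supplies an integer vector (-v, u) whose determinant with m is 1. It differs from the
normal step by a multiple of m, so integer translations carry the given line onto all its neighbours
at spacing h. -/
theorem hessian_estimates_of_closed_line {F : ℝ × ℝ → ℝ} (hF : ContDiff ℝ 4 F)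
    (hp : ∀ x m, F (x + intVec m) = F x) {ε : ℝ}
    (hε : ∀ x, ‖fderiv ℝ (fderiv ℝ (fderiv ℝ (fderiv ℝ F))) x‖ ≤ ε) {x₀ : ℝ × ℝ} {m : ℤ × ℤ}
    (hm : IsCoprime m.1 m.2) {h a : ℝ} (h0 : 0 < h)
    (hh : h ^ 2 * ((m.1 : ℝ) ^ 2 + (m.2 : ℝ) ^ 2) = 1)
    (hd : ∀ t : ℝ, fderiv ℝ F (x₀ + t • intVec m) = 0) (ha : ∀ t : ℝ, F (x₀ + t • intVec m) = a) :
    (∀ y, ‖fderiv ℝ (fderiv ℝ F) y‖ ≤ 6 * ε * h ^ 2) ∧ ∀ y, |F y - a| ≤ 6 * ε * h ^ 4 := by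
  obtain ⟨u, v, huv⟩ := hm
  have huv' : (u : ℝ) * m.1 + v * m.2 = 1 := by exact_mod_cast huv
  have hpd : ∀ x m, fderiv ℝ F (x + intVec m) = fderiv ℝ F x := by
    intro x m
    have := fderiv_comp_add_right (𝕜 := ℝ) (f := F) (x := x) (intVec m)
    simp only [hp] at this
    exact this.symm
  have key : ∀ (t : ℝ) (j : ℤ), ∃ (t' : ℝ) (k : ℤ × ℤ), x₀ + t • intVec m +
      (j : ℝ) • (-(intVec m).2 * h ^ 2, (intVec m).1 * h ^ 2) = x₀ + t' • intVec m + intVec k := by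
    intro t j
    refine ⟨t - j * ((-v * m.1 + u * m.2) * h ^ 2), (-j * v, j * u), ?_⟩
    have e : ∀ c : ℝ, c = c * (h ^ 2 * ((m.1 : ℝ) ^ 2 + (m.2 : ℝ) ^ 2)) := fun c => by
      rw [hh, mul_one]
    ext
    · simp only [Prod.fst_add, Prod.smul_fst, smul_eq_mul, intVec_fst, intVec_snd]
      push_cast
      linear_combination (-j * m.2 * h ^ 2 : ℝ) * (huv').symm - e (-j * v)
    · simp only [Prod.snd_add, Prod.smul_snd, smul_eq_mul, intVec_fst, intVec_snd]
      push_cast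
      linear_combination (j * m.1 * h ^ 2 : ℝ) * (huv').symm - e (j * u)
  refine hessian_estimates hF hε (x₀ := x₀) (m := intVec m) h0 hh (fun t j => ?_) (fun t j => ?_)
  · obtain ⟨t', k, e⟩ := key t j
    rw [e, hpd, hd]
  · obtain ⟨t', k, e⟩ := key t j
    rw [e, hp, ha]

end Estimates

/-! ### Diophantine approximation of the direction (p₀, q₀). -/

section Diophantine

variable {p₀ q₀ : ℝ}

lemma ne_zero_of_isQuadraticIrrational_div (hquad : IsQuadraticIrrational (p₀ / q₀)) : q₀ ≠ 0 := by
  rintro rfl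
  simpa using hquad.1

/-- Liouville's argument: the binary quadratic form of r takes nonzero integer values at m ≠ 0, as a
zero would make r rational, and m.1 - r * m.2 is one of its factors. -/
lemma exists_pos_le_abs_mul_abs_of_quadratic {r : ℝ} (hr : IsQuadraticIrrational r) :
    ∃ D : ℝ, 0 < D ∧ ∀ m : ℤ × ℤ, m ≠ 0 →
      1 ≤ |m.1 - r * m.2| * (D * (|(m.1 : ℝ)| + |(m.2 : ℝ)|)) := by
  obtain ⟨hirr, a, b, c, ha, habc⟩ := hr
  have ha' : (0 : ℝ) < |(a : ℝ)| := by positivity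
  refine ⟨|(a : ℝ)| * (1 + |r|) + |(b : ℝ)|, by positivity, fun m hm => ?_⟩
  have hfac : ((a * m.1 ^ 2 + b * m.1 * m.2 + c * m.2 ^ 2 : ℤ) : ℝ) =
      (m.1 - r * m.2) * (a * (m.1 + r * m.2) + b * m.2) := by
    push_cast
    linear_combination (m.2 : ℝ) ^ 2 * habc
  have hne : (a * m.1 ^ 2 + b * m.1 * m.2 + c * m.2 ^ 2 : ℤ) ≠ 0 := by
    intro h0
    rw [h0, Int.cast_zero, eq_comm, mul_eq_zero] at hfac
    by_cases h2 : m.2 = 0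
    · have h1 : m.1 = 0 := by simpa [h2, ha] using hfac
      exact hm (Prod.ext h1 h2)
    · have h2' : (m.2 : ℝ) ≠ 0 := by exact_mod_cast h2
      have ha2 : (a : ℝ) ≠ 0 := by exact_mod_cast ha
      rcases hfac with h | h
      · refine hirr ⟨(m.1 / m.2 : ℚ), ?_⟩
        push_cast
        field_simp
        linarith
      · refine hirr ⟨(-(a * m.1 + b * m.2) / (a * m.2) : ℚ), ?_⟩
        push_cast
        field_simp
        linarith
  have h1 : (1 : ℝ) ≤ |((a * m.1 ^ 2 + b * m.1 * m.2 + c * m.2 ^ 2 : ℤ) : ℝ)| := by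
    exact_mod_cast Int.one_le_abs hne
  rw [hfac, abs_mul] at h1
  refine h1.trans (mul_le_mul_of_nonneg_left ?_ (abs_nonneg _))
  calc |(a * (m.1 + r * m.2) + b * m.2 : ℝ)|
      ≤ |(a : ℝ)| * (|(m.1 : ℝ)| + |r| * |(m.2 : ℝ)|) + |(b : ℝ)| * |(m.2 : ℝ)| := by
        refine (abs_add_le _ _).trans ?_
        rw [abs_mul, abs_mul, ← abs_mul r]
        gcongr
        exact abs_add_le _ _
    _ ≤ _ := by
        nlinarith [abs_nonneg (m.1 : ℝ), abs_nonneg (m.2 : ℝ), abs_nonneg r, abs_nonneg (b : ℝ),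
          mul_nonneg ha'.le (mul_nonneg (abs_nonneg r) (abs_nonneg (m.1 : ℝ))),
          mul_nonneg ha'.le (abs_nonneg (m.2 : ℝ)),
          mul_nonneg (abs_nonneg (b : ℝ)) (abs_nonneg (m.1 : ℝ))]

/-- A direction with quadratic slope is badly approximable. -/
lemma exists_pos_le_cross_sq (hquad : IsQuadraticIrrational (p₀ / q₀)) :
    ∃ c : ℝ, 0 < c ∧ ∀ m : ℤ × ℤ, m ≠ 0 →
      c ≤ (m.1 * q₀ - m.2 * p₀) ^ 2 * ((m.1 : ℝ) ^ 2 + (m.2 : ℝ) ^ 2) := by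
  have hq := ne_zero_of_isQuadraticIrrational_div hquad
  obtain ⟨D, hD, h⟩ := exists_pos_le_abs_mul_abs_of_quadratic hquad
  refine ⟨q₀ ^ 2 / (2 * D ^ 2), by positivity, fun m hm => ?_⟩
  have h1 := h m hm
  have h2 : (1 : ℝ) ≤ (|m.1 - p₀ / q₀ * m.2| * (D * (|(m.1 : ℝ)| + |(m.2 : ℝ)|))) ^ 2 :=
    one_le_pow₀ h1
  have h3 : (|(m.1 : ℝ)| + |(m.2 : ℝ)|) ^ 2 ≤ 2 * ((m.1 : ℝ) ^ 2 + (m.2 : ℝ) ^ 2) := by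
    nlinarith [sq_nonneg (|(m.1 : ℝ)| - |(m.2 : ℝ)|), sq_abs (m.1 : ℝ), sq_abs (m.2 : ℝ)]
  have h4 : (m.1 * q₀ - m.2 * p₀) ^ 2 = q₀ ^ 2 * (m.1 - p₀ / q₀ * m.2) ^ 2 := by
    field_simp
  rw [mul_pow, mul_pow, sq_abs] at h2
  rw [div_le_iff₀ (by positivity), h4]
  have h5 : (m.1 - p₀ / q₀ * m.2) ^ 2 * (D ^ 2 * (|(m.1 : ℝ)| + |(m.2 : ℝ)|) ^ 2) ≤
      (m.1 - p₀ / q₀ * m.2) ^ 2 * (D ^ 2 * (2 * ((m.1 : ℝ) ^ 2 + (m.2 : ℝ) ^ 2))) := by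
    gcongr
  calc q₀ ^ 2 = q₀ ^ 2 * 1 := by ring
    _ ≤ q₀ ^ 2 * ((m.1 - p₀ / q₀ * m.2) ^ 2 * (D ^ 2 * (2 * ((m.1 : ℝ) ^ 2 + (m.2 : ℝ) ^ 2)))) := by
        gcongr
        exact h2.trans h5
    _ = _ := by ring

/-- The distance from m/T to ω is at least the cross product over T. Bad approximability bounds the
cross product below by a multiple of h, and |m|/T ≥ 1/2 bounds 1/T below by h/2. -/
lemma exists_pos_mul_pow_four_le (hnorm : p₀ ^ 2 + q₀ ^ 2 = 1)
    (hquad : IsQuadraticIrrational (p₀ / q₀)) :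
    ∃ c : ℝ, 0 < c ∧ ∀ (m : ℤ × ℤ) (T h : ℝ), 0 < T → 0 < h →
      h ^ 2 * ((m.1 : ℝ) ^ 2 + (m.2 : ℝ) ^ 2) = 1 →
      (m.1 / T - p₀) ^ 2 + (m.2 / T - q₀) ^ 2 ≤ 1 / 4 →
      c * h ^ 4 ≤ ((m.1 / T - p₀) ^ 2 + (m.2 / T - q₀) ^ 2) / 2 := by
  obtain ⟨c, hc, h⟩ := exists_pos_le_cross_sq hquad
  refine ⟨c / 8, by positivity, fun m T h' hT h0 hh hle => ?_⟩
  have hm : m ≠ 0 := by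
    rintro rfl
    simp at hh
  have h1 := h m hm
  set R := (m.1 : ℝ) ^ 2 + (m.2 : ℝ) ^ 2 with hR
  set X := m.1 * q₀ - m.2 * p₀ with hX
  set d := (m.1 / T - p₀) ^ 2 + (m.2 / T - q₀) ^ 2 with hd
  have hw : (m.1 / T) ^ 2 + (m.2 / T) ^ 2 = R / T ^ 2 := by
    rw [hR]; field_simp
  have hw1 : 1 / 4 ≤ R / T ^ 2 := by
    rw [← hw]
    nlinarith [sq_nonneg (m.1 / T + (m.1 / T - p₀)), sq_nonneg (m.2 / T + (m.2 / T - q₀))]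
  have hXd : X ^ 2 / T ^ 2 ≤ d := by
    have e : X ^ 2 / T ^ 2 = ((m.1 / T - p₀) * q₀ - (m.2 / T - q₀) * p₀) ^ 2 := by
      rw [hX]; field_simp; ring
    have e2 : d = d * (p₀ ^ 2 + q₀ ^ 2) := by rw [hnorm, mul_one]
    rw [e, e2, hd]
    nlinarith [sq_nonneg ((m.1 / T - p₀) * p₀ + (m.2 / T - q₀) * q₀)]
  have e1 : c * h' ^ 2 ≤ X ^ 2 := by
    calc c * h' ^ 2 ≤ X ^ 2 * R * h' ^ 2 := by gcongr
      _ = X ^ 2 * (h' ^ 2 * R) := by ring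
      _ = X ^ 2 := by rw [hh, mul_one]
  have e2 : h' ^ 2 / 4 ≤ 1 / T ^ 2 := by
    calc h' ^ 2 / 4 = h' ^ 2 * (1 / 4) := by ring
      _ ≤ h' ^ 2 * (R / T ^ 2) := by gcongr
      _ = (h' ^ 2 * R) / T ^ 2 := by ring
      _ = _ := by rw [hh]
  have e3 : (c * h' ^ 2) * (h' ^ 2 / 4) ≤ X ^ 2 * (1 / T ^ 2) := by gcongr
  have e4 : X ^ 2 * (1 / T ^ 2) = X ^ 2 / T ^ 2 := by ring
  nlinarith

lemma exists_dirichlet_direction (hnorm : p₀ ^ 2 + q₀ ^ 2 = 1) (hq : q₀ ≠ 0) {n : ℕ}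
    (hn : 0 < n) : ∃ j k : ℤ, (1 : ℝ) ≤ k ∧ (k : ℝ) ≤ n ∧ |(j : ℝ)| ≤ |p₀ / q₀| * n + 1 ∧
      (j * q₀ - k * p₀) ^ 2 * ((n : ℝ) + 1) ^ 2 ≤ 1 := by
  obtain ⟨j, k, hk0, hkn, hjk⟩ := Real.exists_int_int_abs_mul_sub_le (p₀ / q₀) hn
  have hn0' : (1 : ℝ) ≤ n := by exact_mod_cast hn
  have hk1 : (1 : ℝ) ≤ k := by exact_mod_cast hk0
  have hkn' : (k : ℝ) ≤ n := by exact_mod_cast hkn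
  refine ⟨j, k, hk1, hkn', ?_, ?_⟩
  · have e : (j : ℝ) = k * (p₀ / q₀) - (k * (p₀ / q₀) - j) := by ring
    have : (1 : ℝ) / (n + 1) ≤ 1 := by
      rw [div_le_one (by positivity)]; linarith
    rw [e]
    refine (abs_sub _ _).trans ?_
    rw [abs_mul, abs_of_nonneg (by linarith : (0 : ℝ) ≤ k), mul_comm]
    exact add_le_add (mul_le_mul_of_nonneg_left hkn' (abs_nonneg _)) (hjk.trans this)
  · have e : j * q₀ - k * p₀ = -q₀ * (k * (p₀ / q₀) - j) := by field_simp; ring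
    have e1 : |k * (p₀ / q₀) - j| * (n + 1) ≤ 1 := by
      rwa [le_div_iff₀ (by positivity)] at hjk
    have e2 : (|k * (p₀ / q₀) - j| * (n + 1)) ^ 2 ≤ 1 := pow_le_one₀ (by positivity) e1
    rw [mul_pow, sq_abs] at e2
    have hq1 : q₀ ^ 2 ≤ 1 := by nlinarith [sq_nonneg p₀]
    rw [e]
    calc (-q₀ * (k * (p₀ / q₀) - j)) ^ 2 * ((n : ℝ) + 1) ^ 2
        = q₀ ^ 2 * ((k * (p₀ / q₀) - j) ^ 2 * ((n : ℝ) + 1) ^ 2) := by ring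
      _ ≤ 1 * 1 := mul_le_mul hq1 e2 (by positivity) zero_le_one
      _ = 1 := by norm_num

/-- Dirichlet makes the cross product X small but leaves the size D of the vector unbounded below.
Bad approximability gives D² ≥ c/(2X²), so X²/(2D²) ≤ X⁴/c, and |X| ≤ h/M. -/
lemma sq_div_sq_le_of_cross_le {X D n h M c η : ℝ} (hn0 : 0 ≤ n) (h0 : 0 < h) (hη : 0 < η)
    (hM0 : 0 ≤ M) (hn1 : M ≤ n * h) (hM2 : 1 ≤ M ^ 4 * (c * η)) (hX2 : X ^ 2 * (n + 1) ^ 2 ≤ 1)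
    (hD : 0 < D ^ 2) (hc : c ≤ X ^ 2 * (2 * D ^ 2)) : X ^ 2 / D ^ 2 / 2 ≤ η * h ^ 4 := by
  rw [div_div, div_le_iff₀ (by positivity)]
  have a2 : X ^ 2 * M ^ 2 ≤ h ^ 2 := by
    have : M ^ 2 ≤ (n * h) ^ 2 := by gcongr
    calc X ^ 2 * M ^ 2 ≤ X ^ 2 * (n * h) ^ 2 := by gcongr
      _ = (X ^ 2 * n ^ 2) * h ^ 2 := by ring
      _ ≤ (X ^ 2 * (n + 1) ^ 2) * h ^ 2 := by gcongr; linarith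
      _ ≤ 1 * h ^ 2 := by gcongr
      _ = _ := by ring
  have a3 : X ^ 2 * X ^ 2 * M ^ 4 ≤ h ^ 4 := by
    calc X ^ 2 * X ^ 2 * M ^ 4 = (X ^ 2 * M ^ 2) * (X ^ 2 * M ^ 2) := by ring
      _ ≤ h ^ 2 * h ^ 2 := by gcongr
      _ = _ := by ring
  calc X ^ 2 = X ^ 2 * 1 := by ring
    _ ≤ X ^ 2 * (M ^ 4 * (c * η)) := by gcongr
    _ ≤ X ^ 2 * (M ^ 4 * ((X ^ 2 * (2 * D ^ 2)) * η)) := by gcongr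
    _ = (X ^ 2 * X ^ 2 * M ^ 4) * (η * (2 * D ^ 2)) := by ring
    _ ≤ h ^ 4 * (η * (2 * D ^ 2)) := by gcongr
    _ = _ := by ring

/-- Dividing by the projection onto ω leaves an error orthogonal to ω. -/
lemma sq_dist_direction_eq (hnorm : p₀ ^ 2 + q₀ ^ 2 = 1) {x y : ℝ} (hD : x * p₀ + y * q₀ ≠ 0) :
    (x / (x * p₀ + y * q₀) - p₀) ^ 2 + (y / (x * p₀ + y * q₀) - q₀) ^ 2 =
      (x * q₀ - y * p₀) ^ 2 / (x * p₀ + y * q₀) ^ 2 := by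
  have hXR : (x * p₀ + y * q₀) ^ 2 + (x * q₀ - y * p₀) ^ 2 = x ^ 2 + y ^ 2 := by
    linear_combination (x ^ 2 + y ^ 2) * hnorm
  obtain ⟨D, hD'⟩ : ∃ D, x * p₀ + y * q₀ = D := ⟨_, rfl⟩
  rw [hD'] at hXR hD ⊢
  rw [div_sub' hD, div_sub' hD, div_pow, div_pow, ← add_div]
  congr 1
  linear_combination -2 * D * hD' - hXR + D ^ 2 * hnorm

/-- Good approximations, by integer vectors of controlled size, of a direction with quadratic
slope. -/
lemma exists_good_approximation (hnorm : p₀ ^ 2 + q₀ ^ 2 = 1)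
    (hquad : IsQuadraticIrrational (p₀ / q₀)) {η : ℝ} (hη : 0 < η) :
    ∃ A : ℝ, 0 < A ∧ ∀ h : ℝ, 0 < h → h ≤ 1 → ∃ (k : ℤ × ℤ) (τ : ℝ), 0 < τ ∧ τ * h ≤ A ∧
      ((k.1 / τ - p₀) ^ 2 + (k.2 / τ - q₀) ^ 2) / 2 ≤ η * h ^ 4 := by
  have hq := ne_zero_of_isQuadraticIrrational_div hquad
  obtain ⟨c, hc, hcr⟩ := exists_pos_le_cross_sq hquad
  set M := max 1 (1 / (c * η)) with hM
  have hM1 : 1 ≤ M := le_max_left _ _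
  have hM2 : 1 ≤ M ^ 4 * (c * η) := by
    have : 1 / (c * η) ≤ M := le_max_right _ _
    rw [div_le_iff₀ (by positivity)] at this
    refine this.trans ?_
    gcongr
    exact le_self_pow₀ hM1 (by norm_num)
  refine ⟨(|p₀ / q₀| + 2) * (M + 1), by positivity, fun h h0 h1 => ?_⟩
  -- Denominators up to about M/h: M large makes the error beat η, while n * h stays bounded, which
  -- later bounds τ * h.
  set n := ⌈M / h⌉₊ with hn
  have hn1 : M ≤ n * h := by
    rw [← div_le_iff₀ h0]; exact Nat.le_ceil _
  have hn2 : n * h ≤ M + 1 := by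
    have := (Nat.ceil_lt_add_one (show 0 ≤ M / h by positivity)).le
    rw [← hn] at this
    calc n * h ≤ (M / h + 1) * h := by gcongr
      _ = M + h := by field_simp
      _ ≤ _ := by linarith
  have hn0 : 0 < n := Nat.ceil_pos.2 (by positivity)
  have hn0' : (1 : ℝ) ≤ n := by exact_mod_cast hn0
  obtain ⟨j, k, hk1, hkn, hj, hX2⟩ := exists_dirichlet_direction hnorm hq hn0
  have hXR : (j * p₀ + k * q₀) ^ 2 + (j * q₀ - k * p₀) ^ 2 = (j : ℝ) ^ 2 + (k : ℝ) ^ 2 := by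
    linear_combination ((j : ℝ) ^ 2 + (k : ℝ) ^ 2) * hnorm
  have hcross : c ≤ (j * q₀ - k * p₀) ^ 2 * ((j : ℝ) ^ 2 + (k : ℝ) ^ 2) := hcr (j, k) fun h => by
    rw [Prod.mk_eq_zero] at h
    rw [h.2] at hk1
    norm_num at hk1
  have hR1 : 1 ≤ (j : ℝ) ^ 2 + (k : ℝ) ^ 2 := by nlinarith [sq_nonneg (j : ℝ)]
  have hX4 : (j * q₀ - k * p₀) ^ 2 ≤ 1 / 4 := by
    have : (4 : ℝ) ≤ ((n : ℝ) + 1) ^ 2 := by nlinarith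
    have := mul_le_mul_of_nonneg_left this (sq_nonneg (j * q₀ - k * p₀))
    linarith
  have hD2 : 0 < (j * p₀ + k * q₀) ^ 2 := by linarith
  have hD0 : j * p₀ + k * q₀ ≠ 0 := by
    intro h
    simp [h] at hD2
  have hbound := sq_div_sq_le_of_cross_le (by positivity) h0 hη (by positivity) hn1 hM2 hX2 hD2
    (hcross.trans (mul_le_mul_of_nonneg_left (by linarith) (sq_nonneg _)))
  have hsize : |j * p₀ + k * q₀| * h ≤ (|p₀ / q₀| + 2) * (M + 1) := by
    have c1 : |p₀| ≤ 1 := by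
      rw [← sq_le_one_iff_abs_le_one]; nlinarith [sq_nonneg q₀]
    have c2 : |q₀| ≤ 1 := by
      rw [← sq_le_one_iff_abs_le_one]; nlinarith [sq_nonneg p₀]
    have b2 : |j * p₀ + k * q₀| ≤ (|p₀ / q₀| + 2) * n := by
      refine (abs_add_le _ _).trans ?_
      rw [abs_mul, abs_mul, abs_of_nonneg (by linarith : (0 : ℝ) ≤ k)]
      calc |(j : ℝ)| * |p₀| + k * |q₀| ≤ (|p₀ / q₀| * n + 1) * 1 + n * 1 := by gcongr
        _ ≤ _ := by linarith
    calc |j * p₀ + k * q₀| * h ≤ (|p₀ / q₀| + 2) * n * h := by gcongr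
      _ = (|p₀ / q₀| + 2) * (n * h) := by ring
      _ ≤ _ := by gcongr
  -- The time must be positive, so the vector is reversed when it points away from ω.
  rcases lt_or_gt_of_ne hD0 with h | h
  · refine ⟨(-j, -k), |j * p₀ + k * q₀|, abs_pos.2 hD0, hsize, ?_⟩
    rw [abs_of_neg h]
    push_cast
    rw [neg_div_neg_eq, neg_div_neg_eq, sq_dist_direction_eq hnorm hD0]
    exact hbound
  · refine ⟨(j, k), |j * p₀ + k * q₀|, abs_pos.2 hD0, hsize, ?_⟩
    rw [abs_of_pos h, sq_dist_direction_eq hnorm hD0]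
    exact hbound

end Diophantine

/-! ### Regularity of the lifted potential. -/

section Gradient

variable {f : Torus → ℝ}

lemma hasFDerivAt_lift (hf : TorusContDiff 4 f) (x : ℝ × ℝ) :
    HasFDerivAt (fun y : ℝ × ℝ => f (torusProj y)) (pairForm (liftGrad f x)) x := by
  rw [← fderiv_eq_pairForm_liftGrad]
  exact (ContDiff.differentiable hf (by norm_num) x).hasFDerivAt

lemma norm_liftGrad_sub_le (hf : TorusContDiff 4 f) {K : ℝ}
    (hK : ∀ x, ‖fderiv ℝ (fderiv ℝ (fun y : ℝ × ℝ => f (torusProj y))) x‖ ≤ K) (x y : ℝ × ℝ) :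
    ‖liftGrad f x - liftGrad f y‖ ≤ K * ‖x - y‖ := by
  have c0 : ContDiff ℝ (4 : ℕ) (fun y : ℝ × ℝ => f (torusProj y)) := hf
  have c1 : ContDiff ℝ (3 : ℕ) (fderiv ℝ (fun y : ℝ × ℝ => f (torusProj y))) :=
    c0.fderiv_right (by norm_num)
  have h := convex_univ.norm_image_sub_le_of_norm_fderiv_le (𝕜 := ℝ)
    (fun x _ => c1.differentiable (by norm_num) x) (fun x _ => hK x) (Set.mem_univ y)
    (Set.mem_univ x)
  refine le_trans ?_ h
  set A := fderiv ℝ (fun y : ℝ × ℝ => f (torusProj y))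
  have h1 : ‖((1, 0) : ℝ × ℝ)‖ ≤ 1 := by simp [Prod.norm_def]
  have h2 : ‖((0, 1) : ℝ × ℝ)‖ ≤ 1 := by simp [Prod.norm_def]
  exact max_le ((A x - A y).unit_le_opNorm _ h1) ((A x - A y).unit_le_opNorm _ h2)

lemma exists_lipschitzWith_liftGrad (hf : TorusContDiff 4 f) :
    ∃ K : NNReal, LipschitzWith K (liftGrad f) := by
  refine ⟨(torusCNorm 4 f).toNNReal, LipschitzWith.of_dist_le_mul fun x y => ?_⟩
  rw [dist_eq_norm, dist_eq_norm, Real.coe_toNNReal _ ((abs_nonneg _).trans (abs_le_torusCNorm hf 0))]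
  exact norm_liftGrad_sub_le hf (norm_fderiv_two_le_torusCNorm hf) x y

lemma exists_lipschitzWith_lift (hf : TorusContDiff 4 f) :
    ∃ K : NNReal, LipschitzWith K (fun y : ℝ × ℝ => f (torusProj y)) :=
  ⟨(torusCNorm 4 f).toNNReal, lipschitzWith_of_nnnorm_fderiv_le (𝕜 := ℝ)
    (fun x => ContDiff.differentiable hf (by norm_num) x) fun x => by
      rw [← NNReal.coe_le_coe, coe_nnnorm,
        Real.coe_toNNReal _ ((abs_nonneg _).trans (abs_le_torusCNorm hf 0))]
      exact norm_fderiv_le_torusCNorm hf x⟩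

end Gradient

/-! ### Invariance forces the potential to be critical along the line. -/

section InvariantLine

variable {p₀ q₀ : ℝ} {f : Torus → ℝ}

lemma liftGrad_eq_zero_of_velocity {φ : ℝ → TangentTorus → TangentTorus}
    (hφ : IsEulerLagrangeFlow (addPotential (exampleLagrangian p₀ q₀) f) φ) {x w : ℝ × ℝ}
    (h : ∀ n : ℕ, (φ (1 / ((n : ℝ) + 1)) (torusProj x, w)).2 = w) : liftGrad f x = 0 := by
  obtain ⟨h0, horb⟩ := hφ (torusProj x, w)
  obtain ⟨X, X', -, hX', hγ⟩ := isOrbit_addPotential_iff.1 horb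
  have hγ0 := hγ 0
  rw [h0, Prod.mk.injEq, torusProj_eq_iff] at hγ0
  obtain ⟨⟨m, hm⟩, hw⟩ := hγ0
  have h1 := (hX' 0).tendsto_slope_zero_right
  have h2 : Filter.Tendsto (fun n : ℕ => 1 / ((n : ℝ) + 1)) Filter.atTop (nhdsWithin 0 (Set.Ioi 0)) :=
    tendsto_nhdsWithin_iff.2 ⟨tendsto_one_div_add_atTop_nhds_zero_nat,
      Filter.Eventually.of_forall fun n => Set.mem_Ioi.2 Nat.one_div_pos_of_nat⟩
  have h3 := h1.comp h2
  have h4 : ((fun t : ℝ => t⁻¹ • (X' (0 + t) - X' 0)) ∘ fun n : ℕ => 1 / ((n : ℝ) + 1)) =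
      fun _ => 0 := by
    funext n
    have := h n
    rw [hγ] at this
    simp only at this
    simp only [Function.comp, zero_add, this, ← hw, sub_self, smul_zero]
  rw [h4] at h3
  rw [hm, liftGrad_add_intVec]
  exact tendsto_nhds_unique h3 tendsto_const_nhds

/-- All velocities in the support equal w, so the flow of L + f keeps almost every velocity equal to
w, and the acceleration ∇f vanishes. The times 1/(n+1) are countable, so one null set serves them
all; continuity and periodicity then reach every t. -/
lemma liftGrad_eq_zero_of_invariant (hf : TorusContDiff 4 f) {x₀ w : ℝ × ℝ} {T : ℝ} (hT : 0 < T)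
    {m : ℤ × ℤ} (hm : T • w = intVec m)
    (hinv : orbitMeasure (fun t : ℝ => (torusProj (x₀ + t • w), w)) T ∈
      invariantMeasures (addPotential (exampleLagrangian p₀ q₀) f)) (t : ℝ) :
    liftGrad f (x₀ + t • w) = 0 := by
  obtain ⟨-, -, φ, hφ, hpres⟩ := hinv
  set γ : ℝ → TangentTorus := fun t : ℝ => (torusProj (x₀ + t • w), w) with hγ
  have cγ : Continuous γ :=
    (continuous_torusProj.comp (by fun_prop)).prodMk continuous_const
  have hline : Continuous fun t : ℝ => liftGrad f (x₀ + t • w) := by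
    obtain ⟨K, hK⟩ := exists_lipschitzWith_liftGrad hf
    exact hK.continuous.comp (by fun_prop)
  have hV : MeasurableSet {z : TangentTorus | z.2 = w} :=
    (isClosed_singleton.preimage continuous_snd).measurableSet
  have hae : ∀ᵐ z ∂(orbitMeasure γ T), z.2 = w := by
    unfold orbitMeasure
    rw [ae_map_iff cγ.measurable.aemeasurable hV]
    exact Filter.Eventually.of_forall fun _ => rfl
  have hall : ∀ᵐ z ∂(orbitMeasure γ T), ∀ n : ℕ, (φ (1 / ((n : ℝ) + 1)) z).2 = w :=
    ae_all_iff.2 fun n => (hpres _).quasiMeasurePreserving.ae hae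
  have hall' : ∀ᵐ s ∂(volume.restrict (Set.Ioc 0 T)),
      ∀ n : ℕ, (φ (1 / ((n : ℝ) + 1)) (γ s)).2 = w := by
    have h1 := ae_of_ae_map cγ.measurable.aemeasurable hall
    rwa [Measure.ae_ennreal_smul_measure_eq (by simp)] at h1
  have hzero : (fun t : ℝ => liftGrad f (x₀ + t • w)) =ᵐ[volume.restrict (Set.Ioc 0 T)]
      fun _ => 0 := by
    filter_upwards [hall'] with s hs
    exact liftGrad_eq_zero_of_velocity hφ hs
  have hon := Measure.eqOn_Ioc_of_ae_eq volume hzero hline.continuousOn continuousOn_const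
  have hmem := toIocMod_mem_Ioc hT 0 t
  rw [zero_add] at hmem
  have e : x₀ + t • w = x₀ + toIocMod hT 0 t • w +
      intVec (toIocDiv hT 0 t * m.1, toIocDiv hT 0 t * m.2) := by
    have e1 : intVec (toIocDiv hT 0 t * m.1, toIocDiv hT 0 t * m.2) =
        (toIocDiv hT 0 t : ℝ) • intVec m := by
      ext <;> simp
    rw [e1, ← hm, ← self_sub_toIocDiv_zsmul, smul_smul, zsmul_eq_mul, add_assoc, ← add_smul]
    simp
  rw [e, liftGrad_add_intVec]
  exact hon hmem

lemma lift_const_of_liftGrad_eq_zero (hf : TorusContDiff 4 f) {x₀ w : ℝ × ℝ}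
    (h : ∀ t : ℝ, liftGrad f (x₀ + t • w) = 0) (t : ℝ) :
    f (torusProj (x₀ + t • w)) = f (torusProj x₀) := by
  have hd : ∀ t : ℝ, HasDerivAt (fun t : ℝ => f (torusProj (x₀ + t • w))) 0 t := by
    intro t
    have h1 : HasDerivAt (fun s : ℝ => x₀ + s • w) w t := by
      simpa using ((hasDerivAt_id t).smul_const w).const_add x₀
    have := (hasFDerivAt_lift hf (x₀ + t • w)).comp_hasDerivAt t h1
    rw [h, pairForm_apply, Prod.fst_zero, Prod.snd_zero, zero_mul, zero_mul, add_zero] at this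
    exact this
  have := is_const_of_deriv_eq_zero (fun t => (hd t).differentiableAt) (fun t => (hd t).deriv) t 0
  simpa using this

end InvariantLine

/-! ### The competing invariant measure. -/

section ClosedOrbit

variable {p₀ q₀ : ℝ} {f : Torus → ℝ}

/-- The curve z solves the equation on [0, 1] only; the orbit of the flow with the same initial data
follows it over time τ, returns to its starting state and so is periodic. -/
lemma exists_periodic_orbit_of_closed {K : NNReal} (hK : LipschitzWith K (liftGrad f))
    {φ : ℝ → TangentTorus → TangentTorus}
    (hφ : IsEulerLagrangeFlow (addPotential (exampleLagrangian p₀ q₀) f) φ) {τ : ℝ} (hτ : 0 < τ)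
    {z z' : ℝ → ℝ × ℝ} (hz : ∀ t, HasDerivAt z (z' t) t)
    (hz' : ∀ t ∈ Set.Icc (0 : ℝ) 1, HasDerivAt z' (τ ^ 2 • liftGrad f (z t)) t) {k : ℤ × ℤ}
    (h1 : z 1 = z 0 + intVec k) (h1' : z' 1 = z' 0) :
    ∃ δ : ℝ → TangentTorus, IsOrbit (addPotential (exampleLagrangian p₀ q₀) f) δ ∧
      Function.Periodic δ τ ∧
      ∀ t ∈ Set.Icc 0 τ, δ t = (torusProj (z (t / τ)), τ⁻¹ • z' (t / τ)) := by
  obtain ⟨h0, horb⟩ := hφ (torusProj (z 0), τ⁻¹ • z' 0)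
  obtain ⟨X, X', hX, hX', hδ⟩ := isOrbit_addPotential_iff.1 horb
  have hδ0 := hδ 0
  rw [h0, Prod.mk.injEq, torusProj_eq_iff] at hδ0
  obtain ⟨⟨m, hm⟩, hv⟩ := hδ0
  have hdiv : ∀ t, HasDerivAt (fun t : ℝ => t / τ) τ⁻¹ t := fun t => by
    simpa using (hasDerivAt_id t).div_const τ
  have heq : ∀ t ∈ Set.Icc 0 τ, z (t / τ) = X t + intVec m ∧ τ⁻¹ • z' (t / τ) = X' t := by
    refine newton_unique_Icc hK (fun t _ => (hz (t / τ)).scomp t (hdiv t)) (fun t ht => ?_)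
      (fun t _ => (hX t).add_const (intVec m))
      (fun t _ => by rw [liftGrad_add_intVec]; exact hX' t) (by simpa using hm) (by simpa using hv)
    have ht' : t / τ ∈ Set.Icc (0 : ℝ) 1 :=
      ⟨div_nonneg ht.1 hτ.le, (div_le_one hτ).2 ht.2⟩
    have := ((hz' (t / τ) ht').scomp t (hdiv t)).const_smul τ⁻¹
    rw [smul_smul, smul_smul, show τ⁻¹ * τ⁻¹ * τ ^ 2 = 1 by field_simp, one_smul] at this
    exact this
  have hform : ∀ t ∈ Set.Icc 0 τ, φ t (torusProj (z 0), τ⁻¹ • z' 0) =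
      (torusProj (z (t / τ)), τ⁻¹ • z' (t / τ)) := by
    intro t ht
    rw [hδ, (heq t ht).1, (heq t ht).2, torusProj_add_intVec]
  refine ⟨fun t => φ t (torusProj (z 0), τ⁻¹ • z' 0), horb, fun t => ?_, hform⟩
  have hclose : φ τ (torusProj (z 0), τ⁻¹ • z' 0) = φ 0 (torusProj (z 0), τ⁻¹ • z' 0) := by
    rw [hform τ ⟨hτ.le, le_rfl⟩, h0, div_self hτ.ne', h1, h1', torusProj_add_intVec]
  have := IsOrbit.shift_eq hK horb horb (a := τ) (b := 0) hclose t
  simpa [add_comm] using this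

/-- A potential with a small Hessian has an invariant measure whose action is, up to the oscillation
of the potential, that of the uniform motion in a given homotopy class. -/
lemma exists_invariantMeasure_action_le (hnorm : p₀ ^ 2 + q₀ ^ 2 = 1) (hf : TorusContDiff 4 f)
    {φ : ℝ → TangentTorus → TangentTorus}
    (hφ : IsEulerLagrangeFlow (addPotential (exampleLagrangian p₀ q₀) f) φ)
    (hmeas : ∀ t, Measurable (φ t)) (k : ℤ × ℤ) {τ K b : ℝ} (hτ : 0 < τ)
    (hK : ∀ x, ‖fderiv ℝ (fderiv ℝ (fun y : ℝ × ℝ => f (torusProj y))) x‖ ≤ K)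
    (hτK : τ ^ 2 * K ≤ 1 / 4) (hb : ∀ x, f (torusProj x) ≤ b) :
    ∃ ν ∈ invariantMeasures (addPotential (exampleLagrangian p₀ q₀) f),
      ∫ y, addPotential (exampleLagrangian p₀ q₀) f y ∂ν ≤
        ((k.1 / τ - p₀) ^ 2 + (k.2 / τ - q₀) ^ 2) / 2 - 1 / 2 + b := by
  obtain ⟨KF, hKF⟩ := exists_lipschitzWith_lift hf
  obtain ⟨Kg, hKg⟩ := exists_lipschitzWith_liftGrad hf
  have hcf := continuous_of_torusContDiff hf
  -- Rescaling time τ to 1 multiplies the potential by τ².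
  have hgrad : LipschitzWith (1 / 4) fun x => τ ^ 2 • liftGrad f x := by
    refine LipschitzWith.of_dist_le_mul fun x y => ?_
    rw [dist_eq_norm, dist_eq_norm, ← smul_sub, norm_smul, Real.norm_eq_abs,
      abs_of_nonneg (sq_nonneg τ)]
    have h1 := norm_liftGrad_sub_le hf hK x y
    calc τ ^ 2 * ‖liftGrad f x - liftGrad f y‖ ≤ τ ^ 2 * (K * ‖x - y‖) := by gcongr
      _ = τ ^ 2 * K * ‖x - y‖ := by ring
      _ ≤ 1 / 4 * ‖x - y‖ := by gcongr
      _ = _ := by simp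
  have hV : ∀ x, HasFDerivAt (fun x => τ ^ 2 * f (torusProj x))
      (pairForm (τ ^ 2 • liftGrad f x)) x := by
    intro x
    refine ((hasFDerivAt_lift hf x).const_mul (τ ^ 2)).congr_fderiv ?_
    ext <;> simp
  have hVL : LipschitzWith (‖τ ^ 2‖₊ * KF) fun x => τ ^ 2 * f (torusProj x) := by
    refine LipschitzWith.of_dist_le_mul fun x y => ?_
    rw [Real.dist_eq, ← mul_sub, abs_mul, ← Real.dist_eq]
    have := hKF.dist_le_mul x y
    push_cast
    rw [Real.norm_eq_abs, mul_assoc]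
    gcongr
  obtain ⟨z, z', hz, hzc, hz', h1, h1', hmin⟩ := exists_closed_newton hV hgrad hVL
    (fun x m => by rw [torusProj_add_intVec]) (intVec k)
  obtain ⟨δ, hδ, hper, hform⟩ := exists_periodic_orbit_of_closed hKg hφ hτ hz hz' h1 h1'
  refine ⟨orbitMeasure δ τ, orbitMeasure_mem_invariantMeasures hKg hφ hmeas hδ hτ hper, ?_⟩
  rw [integral_orbitMeasure hδ.continuous hτ (continuous_addPotential hcf)]
  have cz : Continuous z := continuous_iff_continuousAt.2 fun t => (hz t).continuousAt
  have cFz : Continuous fun t => f (torusProj (z t)) :=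
    hcf.comp (continuous_torusProj.comp cz)
  have e1 : ∫ t in (0 : ℝ)..τ, addPotential (exampleLagrangian p₀ q₀) f (δ t) =
      τ * ∫ s in (0 : ℝ)..1, addPotential (exampleLagrangian p₀ q₀) f
        (torusProj (z s), τ⁻¹ • z' s) := by
    have : ∀ t ∈ Set.uIcc 0 τ, addPotential (exampleLagrangian p₀ q₀) f (δ t) =
        (fun s => addPotential (exampleLagrangian p₀ q₀) f (torusProj (z s), τ⁻¹ • z' s))
          (t / τ) := by
      intro t ht
      rw [Set.uIcc_of_le hτ.le] at ht
      simp only [hform t ht]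
    rw [intervalIntegral.integral_congr this, intervalIntegral.integral_comp_div
      (fun s => addPotential (exampleLagrangian p₀ q₀) f (torusProj (z s), τ⁻¹ • z' s)) hτ.ne',
      zero_div, div_self hτ.ne', smul_eq_mul]
  have e2 : ∫ s in (0 : ℝ)..1, addPotential (exampleLagrangian p₀ q₀) f
      (torusProj (z s), τ⁻¹ • z' s) =
      (τ⁻¹) ^ 2 * unitAction (fun x => τ ^ 2 * f (torusProj x)) z z' -
        τ⁻¹ * (p₀ * k.1 + q₀ * k.2) := by
    have i1 : ∫ s in (0 : ℝ)..1, (z' s).1 = k.1 := by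
      rw [intervalIntegral.integral_eq_sub_of_hasDerivAt (fun s _ => (hz s).fst)
        (hzc.fst.intervalIntegrable _ _), h1]
      simp
    have i2 : ∫ s in (0 : ℝ)..1, (z' s).2 = k.2 := by
      rw [intervalIntegral.integral_eq_sub_of_hasDerivAt (fun s _ => (hz s).snd)
        (hzc.snd.intervalIntegrable _ _), h1]
      simp
    have i3 : ∀ s, addPotential (exampleLagrangian p₀ q₀) f (torusProj (z s), τ⁻¹ • z' s) =
        (τ⁻¹) ^ 2 * (((z' s).1 ^ 2 + (z' s).2 ^ 2) / 2 + τ ^ 2 * f (torusProj (z s))) -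
          (τ⁻¹ * p₀ * (z' s).1 + τ⁻¹ * q₀ * (z' s).2) := by
      intro s
      simp only [addPotential, exampleLagrangian, Prod.smul_fst, Prod.smul_snd, smul_eq_mul]
      field_simp
      ring
    have i4 : ∫ s in (0 : ℝ)..1, (τ⁻¹ * p₀ * (z' s).1 + τ⁻¹ * q₀ * (z' s).2) =
        τ⁻¹ * (p₀ * k.1 + q₀ * k.2) := by
      rw [intervalIntegral.integral_add, intervalIntegral.integral_const_mul,
        intervalIntegral.integral_const_mul, i1, i2]
      · ring
      all_goals exact Continuous.intervalIntegrable (by fun_prop) _ _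
    unfold unitAction
    simp only [i3]
    rw [intervalIntegral.integral_sub, intervalIntegral.integral_const_mul, i4]
    · exact (continuous_const.mul ((((hzc.fst.pow 2).add (hzc.snd.pow 2)).div_const 2).add
        (continuous_const.mul cFz))).intervalIntegrable _ _
    · exact Continuous.intervalIntegrable (by fun_prop) _ _
  have e3 : unitAction (fun x => τ ^ 2 * f (torusProj x)) z z' ≤
      ((k.1 : ℝ) ^ 2 + (k.2 : ℝ) ^ 2) / 2 + τ ^ 2 * b := by
    refine (hmin 0).trans ?_
    unfold unitAction
    have cF : Continuous fun t : ℝ => f (torusProj (0 + t • intVec k)) :=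
      hcf.comp (continuous_torusProj.comp (by fun_prop))
    calc _ ≤ ∫ _t in (0 : ℝ)..1, (((k.1 : ℝ) ^ 2 + (k.2 : ℝ) ^ 2) / 2 + τ ^ 2 * b) := by
          refine intervalIntegral.integral_mono zero_le_one
            (Continuous.intervalIntegrable (continuous_const.add (continuous_const.mul cF)) _ _)
            (by simp) fun t => ?_
          simp only [intVec_fst, intVec_snd]
          gcongr
          exact hb _
      _ = _ := by simp
  rw [e1, e2, inv_mul_cancel_left₀ hτ.ne']
  calc _ ≤ (τ⁻¹) ^ 2 * (((k.1 : ℝ) ^ 2 + (k.2 : ℝ) ^ 2) / 2 + τ ^ 2 * b) -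
        τ⁻¹ * (p₀ * k.1 + q₀ * k.2) := by gcongr
    _ = ((k.1 / τ - p₀) ^ 2 + (k.2 / τ - q₀) ^ 2) / 2 - (p₀ ^ 2 + q₀ ^ 2) / 2 + b := by
        field_simp
        ring
    _ = _ := by rw [hnorm]

end ClosedOrbit

/-! ### The scale of the closed line, and the comparison of actions. -/

section Main

variable {p₀ q₀ : ℝ}

lemma exists_primitive {m : ℤ × ℤ} (hm : m ≠ 0) :
    ∃ (d : ℤ) (n : ℤ × ℤ), 0 < d ∧ IsCoprime n.1 n.2 ∧ m.1 = d * n.1 ∧ m.2 = d * n.2 := by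
  have hg : 0 < Int.gcd m.1 m.2 := by
    rw [Nat.pos_iff_ne_zero, Ne, Int.gcd_eq_zero_iff]
    exact fun h => hm (Prod.ext h.1 h.2)
  refine ⟨Int.gcd m.1 m.2, (m.1 / Int.gcd m.1 m.2, m.2 / Int.gcd m.1 m.2), by exact_mod_cast hg,
    Int.isCoprime_iff_gcd_eq_one.2 (Int.gcd_div_gcd_div_gcd hg), ?_, ?_⟩
  · exact (Int.mul_ediv_cancel' (Int.gcd_dvd_left ..)).symm
  · exact (Int.mul_ediv_cancel' (Int.gcd_dvd_right ..)).symm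

/-- The estimates on a potential which is critical along a closed line of the flow: `h` is the scale
at which the line is dense. -/
lemma exists_scale (hnorm : p₀ ^ 2 + q₀ ^ 2 = 1) (hquad : IsQuadraticIrrational (p₀ / q₀)) :
    ∃ c : ℝ, 0 < c ∧ ∀ (f : Torus → ℝ) (x₀ w : ℝ × ℝ) (T : ℝ) (m : ℤ × ℤ), TorusContDiff 4 f →
      0 < T → T • w = intVec m → (∀ t : ℝ, liftGrad f (x₀ + t • w) = 0) →
      ∃ h : ℝ, 0 < h ∧ h ≤ 1 ∧ c * h ^ 4 ≤ ((w.1 - p₀) ^ 2 + (w.2 - q₀) ^ 2) / 2 ∧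
        (∀ x, ‖fderiv ℝ (fderiv ℝ (fun y : ℝ × ℝ => f (torusProj y))) x‖ ≤
          6 * torusCNorm 4 f * h ^ 2) ∧
        ∀ x, |f (torusProj x) - f (torusProj x₀)| ≤ 6 * torusCNorm 4 f * h ^ 4 := by
  obtain ⟨c, hc, hcw⟩ := exists_pos_mul_pow_four_le hnorm hquad
  refine ⟨min c (1 / 8), by positivity, fun f x₀ w T m hf hT hm hgrad => ?_⟩
  have hε : 0 ≤ torusCNorm 4 f := (abs_nonneg _).trans (abs_le_torusCNorm hf 0)
  -- If w is far from ω, then h = 1 works with the trivial bounds, the action excess being at least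
  -- 1/8; this disposes of w = 0.
  by_cases hw : (w.1 - p₀) ^ 2 + (w.2 - q₀) ^ 2 ≤ 1 / 4
  · have hm0 : m ≠ 0 := by
      rintro rfl
      have h0 : w = 0 := by
        have : T • w = 0 := by rw [hm]; ext <;> simp
        exact (smul_eq_zero.1 this).resolve_left hT.ne'
      rw [h0] at hw
      simp at hw
      linarith
    obtain ⟨d, n, hd, hn, e1, e2⟩ := exists_primitive hm0
    have hd' : (0 : ℝ) < d := by exact_mod_cast hd
    have hn0 : 0 < n.1 ^ 2 + n.2 ^ 2 := by
      by_contra h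
      have h1 : n.1 = 0 := by nlinarith [sq_nonneg n.1, sq_nonneg n.2]
      have h2 : n.2 = 0 := by nlinarith [sq_nonneg n.1, sq_nonneg n.2]
      rw [h1, h2] at hn
      exact not_isCoprime_zero_zero hn
    have hn1 : (1 : ℝ) ≤ (n.1 : ℝ) ^ 2 + (n.2 : ℝ) ^ 2 := by exact_mod_cast hn0
    have hw1 : w.1 = n.1 / (T / d) := by
      have := congrArg Prod.fst hm
      simp only [Prod.smul_fst, smul_eq_mul, intVec_fst, e1] at this
      push_cast at this
      field_simp
      linarith
    have hw2 : w.2 = n.2 / (T / d) := by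
      have := congrArg Prod.snd hm
      simp only [Prod.smul_snd, smul_eq_mul, intVec_snd, e2] at this
      push_cast at this
      field_simp
      linarith
    set R := (n.1 : ℝ) ^ 2 + (n.2 : ℝ) ^ 2 with hR
    have hh0 : 0 < (√R)⁻¹ := by positivity
    have hh : (√R)⁻¹ ^ 2 * R = 1 := by
      rw [inv_pow, Real.sq_sqrt (by linarith)]
      field_simp
    have hh1 : (√R)⁻¹ ≤ 1 := inv_le_one_of_one_le₀ (by rwa [Real.one_le_sqrt])
    have hnw : intVec n = (T / d) • w := by
      ext
      · simp only [intVec_fst, Prod.smul_fst, smul_eq_mul, hw1]; field_simp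
      · simp only [intVec_snd, Prod.smul_snd, smul_eq_mul, hw2]; field_simp
    have est := hessian_estimates_of_closed_line (F := fun y : ℝ × ℝ => f (torusProj y)) hf
      (fun x m => by rw [torusProj_add_intVec]) (norm_fderiv_four_le_torusCNorm hf)
      (x₀ := x₀) (a := f (torusProj x₀)) hn hh0 hh
      (fun t => by
        rw [fderiv_eq_pairForm_liftGrad, hnw, smul_smul, hgrad]
        ext <;> simp)
      (fun t => by rw [hnw, smul_smul]; exact lift_const_of_liftGrad_eq_zero hf hgrad _)
    refine ⟨(√R)⁻¹, hh0, hh1, ?_, est.1, est.2⟩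
    have := hcw n (T / d) _ (by positivity) hh0 hh
    rw [← hw1, ← hw2] at this
    exact (mul_le_mul_of_nonneg_right (min_le_left _ _) (by positivity)).trans (this hw)
  · refine ⟨1, one_pos, le_rfl, ?_, fun x => ?_, fun x => ?_⟩
    · have := min_le_right c (1 / 8)
      push Not at hw
      linarith
    · have := norm_fderiv_two_le_torusCNorm hf x
      linarith
    · have h1 := abs_le_torusCNorm hf x
      have h2 := abs_le_torusCNorm hf x₀
      have := abs_sub (f (torusProj x)) (f (torusProj x₀))
      linarith

end Main

end

theorem mainTheorem3 (p₀ q₀ : ℝ) (hnorm : p₀ ^ 2 + q₀ ^ 2 = 1)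
    (hquad : IsQuadraticIrrational (p₀ / q₀)) :
    ∃ C : ℝ, 0 < C ∧
      ∀ (γ : ℝ → TangentTorus) (T : ℝ), IsPeriodicOrbit (exampleLagrangian p₀ q₀) γ T →
        ∀ f : Torus → ℝ, TorusContDiff 4 f →
          IsMinimizingOrbit (addPotential (exampleLagrangian p₀ q₀) f) γ T →
            C ≤ torusCNorm 4 f := by
  obtain ⟨c, hc, hscale⟩ := exists_scale hnorm hquad
  obtain ⟨A, hA, happrox⟩ := exists_good_approximation hnorm hquad (η := c / 2) (by positivity)
  -- Below 1/(24A²) the rescaled Hessian is at most 1/4; below c/12 the oscillation 6εh⁴ is less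
  -- than the remaining gap (c/2)h⁴.
  refine ⟨min (c / 12) (1 / (24 * A ^ 2)), by positivity, ?_⟩
  rintro γ T ⟨⟨x, hx, hγ⟩, hT, hper⟩ f hf ⟨hinv, hmin⟩
  by_contra! hlt
  have hε : 0 ≤ torusCNorm 4 f := (abs_nonneg _).trans (abs_le_torusCNorm hf 0)
  obtain ⟨w, hw⟩ := isExtremal_exampleLagrangian hx
  have hder : ∀ t, deriv x t = w := by
    intro t
    have : x = fun t => x 0 + t • w := funext hw
    rw [this]
    simpa using (((hasDerivAt_id t).smul_const w).const_add (x 0)).deriv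
  have hγ' : γ = fun t : ℝ => (torusProj (x 0 + t • w), w) := by
    funext t
    rw [hγ, hder, ← hw]
  obtain ⟨m, hm⟩ : ∃ m : ℤ × ℤ, T • w = intVec m := by
    have h1 := hper 0
    rw [zero_add, hγ, hγ, Prod.mk.injEq, torusProj_eq_iff] at h1
    obtain ⟨⟨m, hm⟩, -⟩ := h1
    rw [hw T] at hm
    exact ⟨m, add_left_cancel hm⟩
  have hgrad := liftGrad_eq_zero_of_invariant hf hT hm (hγ' ▸ hinv)
  obtain ⟨h, h0, h1, hch, hhess, hosc⟩ := hscale f (x 0) w T m hf hT hm hgrad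
  obtain ⟨k, τ, hτ, hτh, hk⟩ := happrox h h0 h1
  have hcf := continuous_of_torusContDiff hf
  have hγc : Continuous γ := by
    rw [hγ']
    exact (continuous_torusProj.comp (by fun_prop)).prodMk continuous_const
  have hact : ∫ y, addPotential (exampleLagrangian p₀ q₀) f y ∂(orbitMeasure γ T) =
      ((w.1 - p₀) ^ 2 + (w.2 - q₀) ^ 2) / 2 - 1 / 2 + f (torusProj (x 0)) := by
    rw [integral_orbitMeasure hγc hT (continuous_addPotential hcf)]
    have : ∀ t, addPotential (exampleLagrangian p₀ q₀) f (γ t) =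
        ((w.1 - p₀) ^ 2 + (w.2 - q₀) ^ 2) / 2 - 1 / 2 + f (torusProj (x 0)) := by
      intro t
      rw [hγ']
      simp only [addPotential, exampleLagrangian, lift_const_of_liftGrad_eq_zero hf hgrad]
      linear_combination (-1 / 2 : ℝ) * hnorm
    simp only [this]
    rw [intervalIntegral.integral_const, sub_zero, smul_eq_mul, inv_mul_cancel_left₀ hT.ne']
  have hlt1 : torusCNorm 4 f < c / 12 := hlt.trans_le (min_le_left _ _)
  have hlt2 : torusCNorm 4 f * (24 * A ^ 2) ≤ 1 := by
    rw [← le_div_iff₀ (by positivity)]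
    exact (hlt.trans_le (min_le_right _ _)).le
  have hτK : τ ^ 2 * (6 * torusCNorm 4 f * h ^ 2) ≤ 1 / 4 := by
    calc τ ^ 2 * (6 * torusCNorm 4 f * h ^ 2) = 6 * torusCNorm 4 f * (τ * h) ^ 2 := by ring
      _ ≤ 6 * torusCNorm 4 f * A ^ 2 := by gcongr
      _ ≤ _ := by linarith
  -- The flow, and the measurability of its time maps, come from the invariance of the measure of γ.
  obtain ⟨φ, hφ, hpres⟩ := hinv.2.2
  obtain ⟨ν, hν, hνact⟩ := exists_invariantMeasure_action_le hnorm hf hφ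
    (fun t => (hpres t).measurable) k hτ hhess hτK
    (b := f (torusProj (x 0)) + 6 * torusCNorm 4 f * h ^ 4)
    (fun y => by linarith [(abs_le.1 (hosc y)).2])
  have hcomp := hmin ν hν
  rw [hact] at hcomp
  have hh : 0 < h ^ 4 := by positivity
  nlinarith
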